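/- Let $\mathcal X,\mathcal Y$ be finite alphabets and let $W_1,W_2$ be two discrete memoryless channels from $\mathcal X$ to $\mathcal Y$. Fix a distribution $Q_0$ on $\mathcal Y$ which is the common output marginal of two non-deterministic input distributions, i.e. there are distributions $P_1,P_2$ on $\mathcal X$, neither of them a point mass, with $\sum_x P_s(x)W_s(y|x)=Q_0(y)$ for all $y$ and $s=1,2$. Let $\mathcal P$ be the set of all pairs $(P_1,P_2)$ of distributions on $\mathcal X$ with $\sum_x P_1(x)W_1(y|x)=\sum_x P_2(x)W_2(y|x)=Q_0(y)$ for all $y$. Logarithms are to base 2. A code of blocklength $n$ with non-empty finite message set $\mathcal M$ and key set $\mathcal K$ consists of encoders $f_s:\mathcal M\times\mathcal K\to\mathcal X^n$ and decoders $g_s:\mathcal Y^n\times\mathcal K\to\mathcal M$, $s=1,2$. The message and key are independent and uniform; $Q_s^n$ denotes the distribution of the output $Y^n$ when $f_s(M,K)$ is sent over $W_s^{n}$, and $P_{\rm e}$ is the maximum over $s$, $k\in\mathcal K$, $m\in\mathcal M$ of $\Pr(g_s(Y^n,K)\ne M\mid K=k,M=m)$ in state $s$. For $\epsilon,\delta_1,\delta_2>0$,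 $L\in[0,\infty)$ and $L_K\in[0,\infty]$, call $(L,L_K)$ $(\epsilon,\delta_1,\delta_2)$-achievable if for every $n$ there is a code $(\mathcal M_n,\mathcal K_n)$ of blocklength $n$ with $P_{\rm e}\le\epsilon$ and $D(Q_s^n\|Q_0^{\times n})\le\delta_s$ for $s=1,2$, such that $\liminf_n \frac1n\log|\mathcal M_n|\ge L$ and $\limsup_n\frac1n\log|\mathcal K_n|\le L_K$. Let $L_1^*(\epsilon,\delta_1,\delta_2)$ be the supremum of all $L$ such that $(L,\infty)$ is achievable (a key of unlimited length), and $L_1^*(0^+,\delta_1,\delta_2)=\lim_{\epsilon\downarrow0}L_1^*(\epsilon,\delta_1,\delta_2)$. Then for all $\delta_1,\delta_2>0$ the limit exists and $$L_1^*(0^+,\delta_1,\delta_2)=\min_{s\in\{1,2\}}\ \max_{(P_1,P_2)\in\mathcal P} I(P_s,W_s),$$ where the maxima are attained. The same holds if $L_1^*(\epsilon,\delta_1,\delta_2)$ is replaced by the supremum of all $L$ such that $(L,L_K)$ is achievable for some finite $L_K$. Moreover a positive rate is achievable, i.e. there is $L>0$ such that $(L,\infty)$ is $(\epsilon,\delta_1,\delta_2)$-achievable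 for every $\epsilon>0$, if and only if there is a pair $(P_1,P_2)\in\mathcal P$ such that for each $s\in\{1,2\}$ the output distributions $W_s(\cdot|x)$, $x\in\operatorname{supp}P_s$, are not all equal. -/

import Mathlib

namespace CompoundCovert

open Filter

noncomputable section

variable {X Y : Type*} [Fintype X] [Fintype Y]

/-- Output marginal of a single-letter channel `V` (rows `V x`) under the input distribution `P`. -/
def outDist (P : X → ℝ) (V : X → Y → ℝ) (y : Y) : ℝ :=
  ∑ x, P x * V x y

/-- Mutual information `I(P, V)` in bits. -/
def mutualInfo (P : X → ℝ) (V : X → Y → ℝ) : ℝ :=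
  ∑ x, ∑ y, P x * V x y * Real.logb 2 (V x y / outDist P V y)

open Classical in
/-- Kullback-Leibler divergence in bits between two pmfs on a finite set; it is `⊤` when the first
is not absolutely continuous with respect to the second. -/
def klDivergence {Z : Type*} [Fintype Z] (P Q : Z → ℝ) : EReal :=
  if ∀ z, Q z = 0 → P z = 0 then ((∑ z, P z * Real.logb 2 (P z / Q z) : ℝ) : EReal) else ⊤

/-- The `n`-fold product distribution. -/
def prodDist {Z : Type*} (Q : Z → ℝ) (n : ℕ) (z : Fin n → Z) : ℝ :=
  ∏ i, Q (z i)

/-- The `n`-fold memoryless extension of a channel. -/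
def prodChannel (V : X → Y → ℝ) (n : ℕ) (x : Fin n → X) (y : Fin n → Y) : ℝ :=
  ∏ i, V (x i) (y i)

/-- Pairs of input distributions (one for each state) which induce the common output
marginal `Q₀` through their respective channels. -/
def maskingPairs (W : Fin 2 → X → Y → ℝ) (Q₀ : Y → ℝ) : Set (Fin 2 → X → ℝ) :=
  {P | (∀ s, P s ∈ stdSimplex ℝ X) ∧ ∀ s y, outDist (P s) (W s) y = Q₀ y}

/-- `Q₀` is the common output marginal of two non-deterministic input distributions. -/
def IsCase1 (W : Fin 2 → X → Y → ℝ) (Q₀ : Y → ℝ) : Prop :=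
  ∃ P ∈ maskingPairs W Q₀, ∀ s, ¬ ∃ x, P s x = 1

/-- A code of blocklength `n` with message set `Fin M`, key set `Fin K`, and state-dependent
encoders and decoders. -/
structure Code (X Y : Type*) (n M K : ℕ) where
  enc : Fin 2 → Fin M → Fin K → (Fin n → X)
  dec : Fin 2 → (Fin n → Y) → Fin K → Fin M

/-- Distribution of the channel output in state `s`, for message and key independent and uniform. -/
def Code.output {n M K : ℕ} (c : Code X Y n M K) (W : Fin 2 → X → Y → ℝ) (s : Fin 2)
    (y : Fin n → Y) : ℝ :=
  (1 / ((M : ℝ) * (K : ℝ))) * ∑ m, ∑ k, prodChannel (W s) n (c.enc s m k) y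

open Classical in
/-- Probability of a decoding error given state `s`, key `k` and message `m`. -/
def Code.errorProb {n M K : ℕ} (c : Code X Y n M K) (W : Fin 2 → X → Y → ℝ) (s : Fin 2)
    (k : Fin K) (m : Fin M) : ℝ :=
  ∑ y : Fin n → Y, if c.dec s y k ≠ m then prodChannel (W s) n (c.enc s m k) y else 0

/-- The maximum error probability (over states, keys and messages) is at most `ε`, and in each
state `s` the divergence of the output distribution from `Q₀ⁿ` is at most `δ s`. -/
def Code.IsKLCode {n M K : ℕ} (c : Code X Y n M K) (W : Fin 2 → X → Y → ℝ) (Q₀ : Y → ℝ)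
    (ε : ℝ) (δ : Fin 2 → ℝ) : Prop :=
  (∀ s k m, c.errorProb W s k m ≤ ε) ∧
    ∀ s, klDivergence (c.output W s) (prodDist Q₀ n) ≤ (δ s : EReal)

/-- `(ε, δ, ζ)`-achievability of the pair `(L, LK)` of message and key throughputs. The value
`LK = ⊤` puts no restriction on the key sizes. -/
def IsAchievable (W : Fin 2 → X → Y → ℝ) (Q₀ : Y → ℝ) (ζ ε : ℝ) (δ : Fin 2 → ℝ)
    (L : ℝ) (LK : EReal) : Prop :=
  ∃ (M K : ℕ → ℕ) (c : ∀ n, Code X Y n (M n) (K n)),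
    (∀ n, 0 < M n ∧ 0 < K n ∧ (c n).IsKLCode W Q₀ ε δ) ∧
    (L : EReal) ≤ liminf (fun n : ℕ => ((Real.logb 2 (M n) / (n : ℝ) ^ ζ : ℝ) : EReal)) atTop ∧
    limsup (fun n : ℕ => ((Real.logb 2 (K n) / (n : ℝ) ^ ζ : ℝ) : EReal)) atTop ≤ LK

/-- Optimal throughput when arbitrarily long keys are available (`LK = ∞`). -/
def optThroughputInfKey (W : Fin 2 → X → Y → ℝ) (Q₀ : Y → ℝ) (ζ ε : ℝ) (δ : Fin 2 → ℝ) : EReal :=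
  sSup {l : EReal | ∃ L : ℝ, 0 ≤ L ∧ l = (L : EReal) ∧ IsAchievable W Q₀ ζ ε δ L ⊤}

/-- Optimal throughput over all finite key throughputs `LK`. -/
def optThroughput (W : Fin 2 → X → Y → ℝ) (Q₀ : Y → ℝ) (ζ ε : ℝ) (δ : Fin 2 → ℝ) : EReal :=
  sSup {l : EReal | ∃ L LK : ℝ, 0 ≤ L ∧ 0 ≤ LK ∧ l = (L : EReal) ∧
    IsAchievable W Q₀ ζ ε δ L (LK : EReal)}

end

end CompoundCovert

namespace CompoundCovert

open Filter

noncomputable section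

variable {X Y : Type*} [Fintype X] [Fintype Y]

/-! Encoder and decoder know the state, so `maskingPairs` is a product of one constraint per state.
The maximising inputs can be chosen separately, and the answer is the minimum of the two maxima.

Direct part, one state at a time: let `P` have output marginal `Q₀`. The key selects a codebook.
Feinstein's argument finds a good codebook of any rate below `I(P, V)` inside every set of words of
`Pⁿ`-mass at least `γ`. Codebooks are picked greedily: by Markov's inequality, the words whose
outputs correlate with the current total by at most `1 / (1 - γ)` times the mean have mass at least
`γ`. With `K` keys the averaged output then has second moment at most `1 / (1 - γ) + 1 / (βⁿ K)`
relative to `Q₀ⁿ`, where `β` bounds the nonzero values of `Q₀` from below. Its logarithm bounds the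
divergence, so a small `γ` and exponentially large `K` suffice; hence a finite key rate is enough.

Converse: the Donsker-Varadhan inequality is used twice. Tested on decoding sets, it bounds `(1 - ε)
log M` by an average row divergence from `Q₀`; tested on letter counts, it forces the average output
marginal towards `Q₀`. A limit point of the average inputs has output exactly `Q₀`, and there the
average row divergence is the mutual information. The loss factor `1 - ε` disappears as `ε` tends to
zero. -/

/-! ### Feinstein codes inside a prescribed set -/

open Classical in
/-- Feinstein's maximal code construction: if the mass of `S` is large enough, codewords in `S`
can be chosen one after the other. -/
theorem exists_partial_code {A B : Type*} [Fintype A] [Fintype B] [Nonempty A]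
    {U : A → B → ℝ} (hU : ∀ a, U a ∈ stdSimplex ℝ B) {p : A → ℝ} (hp : ∀ a, 0 ≤ p a)
    {q : B → ℝ} (hq : ∀ b, ∑ a, p a * U a b = q b) {S : Finset A} {ε θ η : ℝ} (hθ : 0 < θ)
    (hη : ∑ a, p a * ∑ b, (if U a b ≤ θ * q b then U a b else 0) ≤ η) {M : ℕ}
    (hM : η + M / θ < ε * ∑ a ∈ S, p a) {N : ℕ} (hN : N ≤ M) :
    ∃ (c : ℕ → A) (dec : B → ℕ), ∀ i < N, c i ∈ S ∧ (∀ b, dec b = i → θ * q b ≤ U (c i) b) ∧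
      1 - ε ≤ ∑ b, if dec b = i then U (c i) b else 0 := by
  induction N with
  | zero => exact ⟨fun _ => Classical.arbitrary A, fun _ => 0, by simp⟩
  | succ N ih =>
    obtain ⟨c, dec, h⟩ := ih (by omega)
    have hU0 : ∀ a b, 0 ≤ U a b := fun a b => (hU a).1 b
    have hq0 : ∀ b, 0 ≤ q b := fun b => by
      rw [← hq b]; exact Finset.sum_nonneg fun a _ => mul_nonneg (hp a) (hU0 a b)
    -- On a claimed decoding set `θ * q ≤ U (c i)`, so each codeword uses up `q`-mass at most `1 /
    -- θ`.
    have hused : ∑ b, (if dec b < N then q b else 0) ≤ N / θ := by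
      rw [le_div_iff₀ hθ, Finset.sum_mul]
      calc ∑ b, (if dec b < N then q b else 0) * θ
          ≤ ∑ b, ∑ i ∈ Finset.range N, (if dec b = i then U (c i) b else 0) := by
            refine Finset.sum_le_sum fun b _ => ?_
            split_ifs with hb
            · rw [Finset.sum_ite_eq]
              simp only [Finset.mem_range, hb, if_true]
              rw [mul_comm]
              exact (h _ hb).2.1 b rfl
            · rw [zero_mul]
              exact Finset.sum_nonneg fun i _ => by split_ifs <;> simp [hU0]
        _ = ∑ i ∈ Finset.range N, ∑ b, (if dec b = i then U (c i) b else 0) := Finset.sum_comm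
        _ ≤ ∑ i ∈ Finset.range N, ∑ b, U (c i) b := by
            refine Finset.sum_le_sum fun i _ => Finset.sum_le_sum fun b _ => ?_
            split_ifs <;> simp [hU0]
        _ = N := by simp [(hU _).2]
    obtain ⟨a, haS, ha⟩ : ∃ a ∈ S,
        1 - ε ≤ ∑ b, if N ≤ dec b ∧ θ * q b < U a b then U a b else 0 := by
      by_contra! hcon
      -- Each row splits into free outputs of high density, claimed outputs and outputs of low
      -- density. Averaging over `S` contradicts the mass hypothesis.
      have hrow : ∀ a, (1 : ℝ) ≤
          (∑ b, if N ≤ dec b ∧ θ * q b < U a b then U a b else 0)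
          + (∑ b, if dec b < N then U a b else 0)
          + ∑ b, (if U a b ≤ θ * q b then U a b else 0) := by
        intro a
        rw [← (hU a).2, ← Finset.sum_add_distrib, ← Finset.sum_add_distrib]
        refine Finset.sum_le_sum fun b _ => ?_
        have := hU0 a b
        by_cases h1 : dec b < N <;> by_cases h2 : U a b ≤ θ * q b
        · simp [h1, h2, this, not_le.mpr h1]
        · simp [h1, h2, not_le.mpr h1]
        · simp [h1, h2, not_lt.mpr h2, not_lt.mp h1]
        · simp [h1, h2, not_le.mp h2, not_lt.mp h1]
      have h1 : ∑ a ∈ S, p a ≤ (1 - ε) * ∑ a ∈ S, p a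
          + ∑ a, p a * (∑ b, if dec b < N then U a b else 0) + η := by
        have hS1 : ∑ a ∈ S, p a * (∑ b, if dec b < N then U a b else 0)
            ≤ ∑ a, p a * (∑ b, if dec b < N then U a b else 0) :=
          Finset.sum_le_univ_sum_of_nonneg fun a => mul_nonneg (hp a)
            (Finset.sum_nonneg fun b _ => by split_ifs <;> simp [hU0])
        have hS2 : ∑ a ∈ S, p a * (∑ b, if U a b ≤ θ * q b then U a b else 0)
            ≤ ∑ a, p a * (∑ b, if U a b ≤ θ * q b then U a b else 0) :=
          Finset.sum_le_univ_sum_of_nonneg fun a => mul_nonneg (hp a)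
            (Finset.sum_nonneg fun b _ => by split_ifs <;> simp [hU0])
        have : ∑ a ∈ S, p a ≤ ∑ a ∈ S, ((1 - ε) * p a
            + p a * (∑ b, if dec b < N then U a b else 0)
            + p a * (∑ b, if U a b ≤ θ * q b then U a b else 0)) := by
          refine Finset.sum_le_sum fun a ha => ?_
          have := mul_le_mul_of_nonneg_left ((hrow a).trans
            (add_le_add_left (add_le_add_left (hcon a ha).le _) _)) (hp a)
          linarith
        rw [Finset.sum_add_distrib, Finset.sum_add_distrib, ← Finset.mul_sum] at this
        linarith
      have h2 : ∑ a, p a * (∑ b, if dec b < N then U a b else 0)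
          = ∑ b, (if dec b < N then q b else 0) := by
        simp_rw [Finset.mul_sum]
        rw [Finset.sum_comm]
        refine Finset.sum_congr rfl fun b _ => ?_
        split_ifs
        · exact hq b
        · simp
      have h3 : (N : ℝ) / θ ≤ M / θ := by
        gcongr
        omega
      linarith
    -- The value `N + 1` marks an output as still unclaimed for the next codeword.
    refine ⟨Function.update c N a,
      fun b => if dec b < N then dec b else if θ * q b < U a b then N else N + 1, fun i hi => ?_⟩
    rcases Nat.lt_succ_iff_lt_or_eq.mp hi with hi | rfl
    · have hiff : ∀ b, (if dec b < N then dec b else if θ * q b < U a b then N else N + 1) = i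
          ↔ dec b = i := by
        intro b; split_ifs <;> omega
      simp only [hiff, Function.update_of_ne hi.ne]
      exact h i hi
    · have hiff : ∀ b, (if dec b < i then dec b else if θ * q b < U a b then i else i + 1) = i
          ↔ (i ≤ dec b ∧ θ * q b < U a b) := by
        intro b; split_ifs <;> (simp_all <;> omega)
      simp only [hiff, Function.update_self]
      exact ⟨haS, fun b hb => hb.2.le, ha⟩

open Classical in
/-- **Feinstein's lemma** with codewords restricted to a set `S` of positive mass. -/
theorem exists_code_in {A B : Type*} [Fintype A] [Fintype B] [Nonempty A]
    {U : A → B → ℝ} (hU : ∀ a, U a ∈ stdSimplex ℝ B) {p : A → ℝ} (hp : ∀ a, 0 ≤ p a)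
    {q : B → ℝ} (hq : ∀ b, ∑ a, p a * U a b = q b) {S : Finset A} {ε θ η : ℝ} (hθ : 0 < θ)
    (hη : ∑ a, p a * ∑ b, (if U a b ≤ θ * q b then U a b else 0) ≤ η) {M : ℕ} (hM0 : 0 < M)
    (hM : η + M / θ < ε * ∑ a ∈ S, p a) :
    ∃ (c : Fin M → A) (dec : B → Fin M), ∀ m, c m ∈ S ∧
      ∑ b, (if dec b ≠ m then U (c m) b else 0) ≤ ε := by
  obtain ⟨c, dec, h⟩ := exists_partial_code hU hp hq hθ hη hM le_rfl
  -- Unclaimed outputs go to message `0`; this can only remove errors.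
  refine ⟨fun m => c m, fun b => if hb : dec b < M then ⟨dec b, hb⟩ else ⟨0, hM0⟩, fun m => ?_⟩
  obtain ⟨h1, -, h3⟩ := h m m.2
  refine ⟨h1, ?_⟩
  have hsum : ∑ b, (if dec b = m then U (c m) b else 0)
      + ∑ b, (if dec b ≠ m then U (c m) b else 0) = 1 := by
    rw [← (hU (c m)).2, ← Finset.sum_add_distrib]
    exact Finset.sum_congr rfl fun b _ => by split_ifs <;> simp_all
  refine le_trans (Finset.sum_le_sum fun b _ => ?_)
    (show ∑ b, (if dec b ≠ m then U (c m) b else 0) ≤ ε by linarith)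
  have h0 := (hU (c m)).1 b
  by_cases hb : dec b = m
  · have : dec b < M := hb ▸ m.2
    simp [hb]
  · simp only [ne_eq, hb, not_false_eq_true, if_true]
    split_ifs <;> simp [h0]

/-! ### Greedy codebooks with small second moment -/

open Classical in
/-- Greedy choice of `K` codebooks, each from a class which meets every set of mass at least `γ`,
such that the sum of the induced output distributions has small second moment relative
to `q`. -/
theorem exists_codebooks {A B : Type*} [Fintype A] [Fintype B]
    {U : A → B → ℝ} (hU : ∀ a, U a ∈ stdSimplex ℝ B) {p : A → ℝ} (hp : p ∈ stdSimplex ℝ A)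
    {q : B → ℝ} (hq : ∀ b, ∑ a, p a * U a b = q b) {β γ : ℝ} (hβ : 0 < β)
    (hqβ : ∀ b, q b ≠ 0 → β ≤ q b) (hγ1 : γ < 1) {ι : Type*} [Fintype ι]
    [Nonempty ι] {D : Type*} (good : (ι → A) → D → Prop)
    (hgood : ∀ S : Finset A, γ ≤ ∑ a ∈ S, p a → ∃ c d, (∀ m, c m ∈ S) ∧ good c d) (K : ℕ) :
    ∃ (c : Fin K → ι → A) (d : Fin K → D), (∀ k, good (c k) (d k)) ∧ (∀ k m, p (c k m) ≠ 0) ∧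
      ∑ b, (∑ k, ∑ m, U (c k m) b) ^ 2 / q b
        ≤ (Fintype.card ι : ℝ) ^ 2 * ((K : ℝ) ^ 2 / (1 - γ) + K / β) := by
  have hU0 : ∀ a b, 0 ≤ U a b := fun a b => (hU a).1 b
  have hq0 : ∀ b, 0 ≤ q b := fun b => by
    rw [← hq b]; exact Finset.sum_nonneg fun a _ => mul_nonneg (hp.1 a) (hU0 a b)
  have hac : ∀ a, p a ≠ 0 → ∀ b, q b = 0 → U a b = 0 := by
    intro a ha b hb
    rw [← hq b, Finset.sum_eq_zero_iff_of_nonneg fun a _ => mul_nonneg (hp.1 a) (hU0 a b)] at hb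
    exact (mul_eq_zero.mp (hb a (Finset.mem_univ a))).resolve_left ha
  have hι : (0 : ℝ) < Fintype.card ι := by exact_mod_cast Fintype.card_pos
  induction K with
  | zero => exact ⟨fun k => k.elim0, fun k => k.elim0, fun k => k.elim0, fun k => k.elim0, by simp⟩
  | succ K ih =>
    obtain ⟨c, d, h1, h2, h3⟩ := ih
    set T : B → ℝ := fun b => ∑ k, ∑ m, U (c k m) b with hT
    have hT0 : ∀ b, 0 ≤ T b := fun b =>
      Finset.sum_nonneg fun k _ => Finset.sum_nonneg fun m _ => hU0 _ _
    have hTsum : ∑ b, T b = K * Fintype.card ι := by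
      rw [hT, Finset.sum_comm]
      have : ∀ k : Fin K, ∑ b, ∑ m, U (c k m) b = Fintype.card ι := fun k => by
        rw [Finset.sum_comm]; simp [(hU _).2]
      simp [this]
    have hTq : ∀ b, q b = 0 → T b = 0 := fun b hb =>
      Finset.sum_eq_zero fun k _ => Finset.sum_eq_zero fun m _ => hac _ (h2 k m) b hb
    -- The correlation of a new word with the current total; its `p`-mean is the total mass of `T`.
    set g : A → ℝ := fun a => ∑ b, T b * U a b / q b with hg
    have hg0 : ∀ a, 0 ≤ g a := fun a => Finset.sum_nonneg fun b _ =>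
      div_nonneg (mul_nonneg (hT0 b) (hU0 a b)) (hq0 b)
    have hgmean : ∑ a, p a * g a = K * Fintype.card ι := by
      rw [← hTsum]
      simp_rw [hg, Finset.mul_sum]
      rw [Finset.sum_comm]
      refine Finset.sum_congr rfl fun b _ => ?_
      by_cases hb : q b = 0
      · simp [hb, hTq b hb]
      · rw [show ∑ a, p a * (T b * U a b / q b) = T b / q b * ∑ a, p a * U a b by
          rw [Finset.mul_sum]; exact Finset.sum_congr rfl fun a _ => by ring]
        rw [hq b]; field_simp
    set τ : ℝ := K * Fintype.card ι / (1 - γ) with hτ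
    have h1γ : 0 < 1 - γ := by linarith
    -- Markov's inequality at level `τ` gives the mass; the condition `p a ≠ 0` preserves absolute
    -- continuity.
    set S : Finset A := Finset.univ.filter fun a => g a ≤ τ ∧ p a ≠ 0 with hS
    have hSmass : γ ≤ ∑ a ∈ S, p a := by
      by_contra! hlt
      have hsplit : ∑ a ∈ S, p a + ∑ a ∈ Sᶜ, p a = 1 := by
        rw [Finset.sum_add_sum_compl]; exact hp.2
      have hτle : τ * ∑ a ∈ Sᶜ, p a ≤ ∑ a, p a * g a := by
        rw [Finset.mul_sum]
        refine le_trans (Finset.sum_le_sum fun a ha => ?_)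
          (Finset.sum_le_univ_sum_of_nonneg (s := Sᶜ) fun a => mul_nonneg (hp.1 a) (hg0 a))
        by_cases hpa : p a = 0
        · simp [hpa]
        · have : τ < g a := by
            by_contra! hle
            simp [hS, hle, hpa] at ha
          rw [mul_comm]
          exact mul_le_mul_of_nonneg_left this.le (hp.1 a)
      -- For `K = 0` the threshold is zero and Markov's inequality is void, but `g` vanishes, so `S`
      -- is the whole support.
      rcases Nat.eq_zero_or_pos K with hK | hK
      · have hSall : ∑ a ∈ Sᶜ, p a = 0 := by
          refine Finset.sum_eq_zero fun a ha => ?_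
          by_contra hpa
          subst hK
          have : g a = 0 := by simp [hg, hT]
          simp [hS, this, hτ, hpa] at ha
        linarith
      · have hKι : (0 : ℝ) < K * Fintype.card ι := by positivity
        have : K * Fintype.card ι < τ * ∑ a ∈ Sᶜ, p a := by
          rw [hτ, div_mul_eq_mul_div, lt_div_iff₀ h1γ]
          exact mul_lt_mul_of_pos_left (by linarith) hKι
        linarith
    obtain ⟨c', d', hc', hgd⟩ := hgood S hSmass
    have hc'' : ∀ m, g (c' m) ≤ τ ∧ p (c' m) ≠ 0 := fun m => by simpa [hS] using hc' m
    refine ⟨Fin.snoc (α := fun _ => ι → A) c c', Fin.snoc (α := fun _ => D) d d', ?_, ?_, ?_⟩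
    · intro k
      refine Fin.lastCases ?_ (fun i => ?_) k
      · simpa using hgd
      · simpa using h1 i
    · intro k
      refine Fin.lastCases ?_ (fun i => ?_) k
      · simpa using fun m => (hc'' m).2
      · simpa using h2 i
    · simp only [Fin.sum_univ_castSucc, Fin.snoc_castSucc, Fin.snoc_last]
      set R : B → ℝ := fun b => ∑ m, U (c' m) b with hR
      have hR0 : ∀ b, 0 ≤ R b := fun b => Finset.sum_nonneg fun m _ => hU0 _ _
      have hRle : ∀ b, R b ≤ Fintype.card ι := fun b => by
        refine (Finset.sum_le_sum fun m _ => show U (c' m) b ≤ 1 from ?_).trans (by simp)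
        rw [← (hU (c' m)).2]
        exact Finset.single_le_sum (fun b _ => hU0 _ b) (Finset.mem_univ b)
      have hRsum : ∑ b, R b = Fintype.card ι := by
        rw [hR, Finset.sum_comm]; simp [(hU _).2]
      have hRq : ∀ b, q b = 0 → R b = 0 := fun b hb =>
        Finset.sum_eq_zero fun m _ => hac _ (hc'' m).2 b hb
      have hcross : ∑ b, T b * R b / q b ≤ Fintype.card ι * τ := by
        calc ∑ b, T b * R b / q b = ∑ m, g (c' m) := by
              simp_rw [hg, hR, Finset.mul_sum, Finset.sum_div]
              exact Finset.sum_comm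
          _ ≤ ∑ m : ι, τ := Finset.sum_le_sum fun m _ => (hc'' m).1
          _ = _ := by simp
      have hsq : ∑ b, R b ^ 2 / q b ≤ (Fintype.card ι : ℝ) ^ 2 / β := by
        calc ∑ b, R b ^ 2 / q b ≤ ∑ b, (Fintype.card ι / β) * R b := by
              refine Finset.sum_le_sum fun b _ => ?_
              by_cases hb : q b = 0
              · simp [hb, hRq b hb]
              · have hqb := hqβ b hb
                calc R b ^ 2 / q b ≤ R b ^ 2 / β := by
                      gcongr
                  _ = R b / β * R b := by ring
                  _ ≤ _ := by
                      have := hRle b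
                      have := hR0 b
                      gcongr
          _ = _ := by rw [← Finset.mul_sum, hRsum]; ring
      have hexp : ∑ b, (T b + R b) ^ 2 / q b
          = ∑ b, T b ^ 2 / q b + 2 * ∑ b, T b * R b / q b + ∑ b, R b ^ 2 / q b := by
        rw [Finset.mul_sum, ← Finset.sum_add_distrib, ← Finset.sum_add_distrib]
        exact Finset.sum_congr rfl fun b _ => by ring
      change ∑ b, (T b + R b) ^ 2 / q b ≤ _
      rw [hexp]
      -- The cross term is absorbed because `(K + 1)² - K² ≥ 2K`.
      have hfin : (Fintype.card ι : ℝ) ^ 2 * ((K : ℝ) ^ 2 / (1 - γ) + K / β)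
          + 2 * (Fintype.card ι * τ) + (Fintype.card ι : ℝ) ^ 2 / β
          ≤ (Fintype.card ι : ℝ) ^ 2 * (((K + 1 : ℕ) : ℝ) ^ 2 / (1 - γ) + ((K + 1 : ℕ) : ℝ) / β) := by
        have : (0 : ℝ) ≤ (Fintype.card ι : ℝ) ^ 2 * (1 / (1 - γ)) := by positivity
        push_cast
        rw [hτ]
        have e : (Fintype.card ι : ℝ) ^ 2 * (((K : ℝ) + 1) ^ 2 / (1 - γ) + ((K : ℝ) + 1) / β)
          = (Fintype.card ι : ℝ) ^ 2 * ((K : ℝ) ^ 2 / (1 - γ) + K / β)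
          + 2 * (Fintype.card ι * (K * Fintype.card ι / (1 - γ))) + (Fintype.card ι : ℝ) ^ 2 / β
          + (Fintype.card ι : ℝ) ^ 2 * (1 / (1 - γ)) := by ring
        linarith
      linarith

/-! ### Divergence inequalities on finite sets -/

theorem sub_le_mul_log_div {p r : ℝ} (hp : 0 ≤ p) (hr : 0 ≤ r) (h : r = 0 → p = 0) :
    p - r ≤ p * Real.log (p / r) := by
  rcases hp.eq_or_lt with rfl | hp
  · simpa using hr
  · have hr : 0 < r := hr.lt_of_ne fun h0 => hp.ne' (h h0.symm)
    have := Real.log_le_sub_one_of_pos (div_pos hr hp)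
    rw [← inv_div r p, Real.log_inv]
    have h2 : p * (r / p) = r := by field_simp
    nlinarith

theorem sub_lt_mul_log_div {p r : ℝ} (hp : 0 ≤ p) (hr : 0 ≤ r) (h : r = 0 → p = 0) (hne : p ≠ r) :
    p - r < p * Real.log (p / r) := by
  rcases hp.eq_or_lt with rfl | hp
  · simpa using hr.lt_of_ne hne
  · have hr : 0 < r := hr.lt_of_ne fun h0 => hp.ne' (h h0.symm)
    have hne' : r / p ≠ 1 := fun h1 => hne ((div_eq_one_iff_eq hp.ne').mp h1).symm
    have := Real.log_lt_sub_one_of_pos (div_pos hr hp) hne'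
    rw [← inv_div r p, Real.log_inv]
    have h2 : p * (r / p) = r := by field_simp
    nlinarith

/-- The **Donsker-Varadhan** inequality on a finite set. -/
theorem sum_mul_le_klDiv_add_log {Z : Type*} [Fintype Z] {p q : Z → ℝ} (hp : p ∈ stdSimplex ℝ Z)
    (hq : ∀ z, 0 ≤ q z) (hac : ∀ z, q z = 0 → p z = 0) (g : Z → ℝ) :
    ∑ z, p z * g z ≤ ∑ z, p z * Real.log (p z / q z)
      + Real.log (∑ z, q z * Real.exp (g z)) := by
  set S := ∑ z, q z * Real.exp (g z) with hS
  have hS0 : 0 < S := by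
    obtain ⟨z, hz⟩ : ∃ z, p z ≠ 0 := by
      by_contra! h0
      have := hp.2
      simp [h0] at this
    refine Finset.sum_pos' (fun z _ => mul_nonneg (hq z) (Real.exp_pos _).le)
      ⟨z, Finset.mem_univ z, mul_pos ((hq z).lt_of_ne fun h => hz (hac z h.symm)) (Real.exp_pos _)⟩
  -- The inequality `p - r ≤ p log (p / r)` against the tilted pmf `r = q e^g / S`.
  have key : ∀ z, p z * g z - p z * Real.log (p z / q z) - p z * Real.log S
      ≤ q z * Real.exp (g z) / S - p z := by
    intro z
    by_cases hz : q z = 0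
    · simp [hz, hac z hz]
    have hqz : 0 < q z := (hq z).lt_of_ne (Ne.symm hz)
    rcases (hp.1 z).eq_or_lt with h0 | hpz
    · rw [← h0]; simp only [zero_mul, sub_zero]; positivity
    have h1 := sub_le_mul_log_div hpz.le
      (show 0 ≤ q z * Real.exp (g z) / S by positivity)
      (fun h => absurd h (by positivity))
    have h2 : Real.log (p z / (q z * Real.exp (g z) / S))
        = Real.log (p z / q z) - g z + Real.log S := by
      rw [show p z / (q z * Real.exp (g z) / S) = p z / q z / Real.exp (g z) * S by field_simp,
        Real.log_mul (by positivity) hS0.ne', Real.log_div (by positivity) (by positivity),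
        Real.log_exp]
    rw [h2] at h1
    linarith
  have hsum := Finset.sum_le_sum fun z (_ : z ∈ Finset.univ) => key z
  simp only [Finset.sum_sub_distrib] at hsum
  rw [← Finset.sum_mul, ← Finset.sum_div, ← hS, hp.2, div_self hS0.ne'] at hsum
  linarith

/-- The divergence is bounded by the logarithm of the second moment of the likelihood ratio. -/
theorem sum_mul_log_div_le_log {Z : Type*} [Fintype Z] {p q : Z → ℝ} (hp : p ∈ stdSimplex ℝ Z)
    (hq : ∀ z, 0 ≤ q z) (hac : ∀ z, q z = 0 → p z = 0) {c : ℝ} (hc : 0 < c)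
    (h : ∑ z, p z ^ 2 / q z ≤ c) :
    ∑ z, p z * Real.log (p z / q z) ≤ Real.log c := by
  -- Jensen's inequality termwise: `log u ≤ u - 1` at `u = p / (q c)`.
  have key : ∀ z, p z * Real.log (p z / q z) - p z * Real.log c ≤ p z ^ 2 / q z / c - p z := by
    intro z
    by_cases hz : q z = 0
    · simp [hz, hac z hz]
    have hqz : 0 < q z := (hq z).lt_of_ne (Ne.symm hz)
    rcases (hp.1 z).eq_or_lt with h0 | hpz
    · rw [← h0]; simp
    have h1 := Real.log_le_sub_one_of_pos (show 0 < p z / q z / c by positivity)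
    rw [Real.log_div (by positivity) hc.ne'] at h1
    have h2 := mul_le_mul_of_nonneg_left h1 hpz.le
    have h3 : p z * (p z / q z / c - 1) = p z ^ 2 / q z / c - p z := by ring
    linarith
  have hsum := Finset.sum_le_sum fun z (_ : z ∈ Finset.univ) => key z
  simp only [Finset.sum_sub_distrib] at hsum
  rw [← Finset.sum_mul, ← Finset.sum_div, hp.2] at hsum
  have : (∑ z, p z ^ 2 / q z) / c ≤ 1 := (div_le_one hc).mpr h
  linarith

/-! ### Product distributions and the information density -/

theorem sum_pi_prod {Z : Type*} [Fintype Z] {n : ℕ} (f : Fin n → Z → ℝ) :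
    ∑ z : Fin n → Z, ∏ i, f i (z i) = ∏ i, ∑ z, f i z := by
  rw [Finset.prod_univ_sum, Fintype.piFinset_univ]

theorem outDist_mem_stdSimplex {P : X → ℝ} (hP : P ∈ stdSimplex ℝ X) {V : X → Y → ℝ}
    (hV : ∀ x, V x ∈ stdSimplex ℝ Y) : outDist P V ∈ stdSimplex ℝ Y := by
  refine ⟨fun y => Finset.sum_nonneg fun x _ => mul_nonneg (hP.1 x) ((hV x).1 y), ?_⟩
  simp only [outDist]
  rw [Finset.sum_comm]
  simp [← Finset.mul_sum, (hV _).2, hP.2]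

theorem outDist_eq_zero {P : X → ℝ} (hP : P ∈ stdSimplex ℝ X) {V : X → Y → ℝ}
    (hV : ∀ x, V x ∈ stdSimplex ℝ Y) {x : X} (hx : P x ≠ 0) {y : Y} (hy : outDist P V y = 0) :
    V x y = 0 := by
  rw [outDist, Finset.sum_eq_zero_iff_of_nonneg
    fun x _ => mul_nonneg (hP.1 x) ((hV x).1 y)] at hy
  exact (mul_eq_zero.mp (hy x (Finset.mem_univ x))).resolve_left hx

theorem prodDist_mem_stdSimplex {P : X → ℝ} (hP : P ∈ stdSimplex ℝ X) (n : ℕ) :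
    prodDist P n ∈ stdSimplex ℝ (Fin n → X) := by
  refine ⟨fun x => Finset.prod_nonneg fun i _ => hP.1 _, ?_⟩
  simp only [prodDist]
  rw [sum_pi_prod (fun _ => P)]
  simp [hP.2]

theorem prodChannel_mem_stdSimplex {X : Type*} {V : X → Y → ℝ} (hV : ∀ x, V x ∈ stdSimplex ℝ Y) (n : ℕ)
    (x : Fin n → X) : prodChannel V n x ∈ stdSimplex ℝ (Fin n → Y) := by
  refine ⟨fun y => Finset.prod_nonneg fun i _ => (hV _).1 _, ?_⟩
  simp only [prodChannel]
  rw [sum_pi_prod (fun i => V (x i))]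
  simp [(hV _).2]

theorem sum_prodDist_mul_prodChannel {Y : Type*} (P : X → ℝ) (V : X → Y → ℝ) (n : ℕ) (y : Fin n → Y) :
    ∑ x, prodDist P n x * prodChannel V n x y = prodDist (outDist P V) n y := by
  simp only [prodDist, prodChannel, outDist, ← Finset.prod_mul_distrib]
  exact sum_pi_prod (fun i x => P x * V x (y i))

theorem pow_le_prodDist {Y : Type*} {q : Y → ℝ} {β : ℝ} (hβ : 0 ≤ β) (h : ∀ y, q y ≠ 0 → β ≤ q y) {n : ℕ}
    {y : Fin n → Y} (hy : prodDist q n y ≠ 0) : β ^ n ≤ prodDist q n y := by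
  rw [prodDist, Finset.prod_ne_zero_iff] at hy
  calc β ^ n = ∏ _i : Fin n, β := by simp
    _ ≤ _ := Finset.prod_le_prod (fun _ _ => hβ) fun i hi => h _ (hy i hi)

/-- Tilted moment bounding the lower tail of the information density. -/
def tilt (P : X → ℝ) (V : X → Y → ℝ) (a t : ℝ) : ℝ :=
  ∑ x, ∑ y, P x * (V x y * Real.exp (t * (a - Real.log (V x y / outDist P V y))))

open Classical in
/-- Chernoff bound for the lower tail of the information density of a memoryless channel. -/
theorem sum_le_tilt_pow {P : X → ℝ} (hP : P ∈ stdSimplex ℝ X) {V : X → Y → ℝ}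
    (hV : ∀ x, V x ∈ stdSimplex ℝ Y) (a : ℝ) {t : ℝ} (ht : 0 ≤ t) (n : ℕ) :
    ∑ x, prodDist P n x * ∑ y, (if prodChannel V n x y
        ≤ Real.exp a ^ n * prodDist (outDist P V) n y then prodChannel V n x y else 0)
      ≤ tilt P V a t ^ n := by
  have hQ := outDist_mem_stdSimplex hP hV
  have hrhs : tilt P V a t ^ n = ∑ x : Fin n → X, prodDist P n x * ∑ y : Fin n → Y,
      ∏ i, (V (x i) (y i)
        * Real.exp (t * (a - Real.log (V (x i) (y i) / outDist P V (y i))))) := by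
    have h1 : ∀ x : Fin n → X, prodDist P n x * ∑ y : Fin n → Y, ∏ i, (V (x i) (y i)
        * Real.exp (t * (a - Real.log (V (x i) (y i) / outDist P V (y i)))))
        = ∏ i, ∑ y, P (x i) * (V (x i) y
        * Real.exp (t * (a - Real.log (V (x i) y / outDist P V y)))) := by
      intro x
      rw [sum_pi_prod (fun i y => V (x i) y
        * Real.exp (t * (a - Real.log (V (x i) y / outDist P V y)))), prodDist,
        ← Finset.prod_mul_distrib]
      simp_rw [Finset.mul_sum]
    simp_rw [h1]
    rw [sum_pi_prod (fun _ x => ∑ y, P x * (V x y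
        * Real.exp (t * (a - Real.log (V x y / outDist P V y)))))]
    simp [tilt]
  rw [hrhs]
  refine Finset.sum_le_sum fun x _ => ?_
  have hPx := (prodDist_mem_stdSimplex hP n).1 x
  by_cases hx : prodDist P n x = 0
  · simp [hx]
  refine mul_le_mul_of_nonneg_left (Finset.sum_le_sum fun y _ => ?_) hPx
  have hnn : 0 ≤ ∏ i, (V (x i) (y i)
      * Real.exp (t * (a - Real.log (V (x i) (y i) / outDist P V (y i))))) :=
    Finset.prod_nonneg fun i _ => mul_nonneg ((hV _).1 _) (Real.exp_pos _).le
  split_ifs with hle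
  · by_cases hU : prodChannel V n x y = 0
    · rw [hU]; exact hnn
    have hVi : ∀ i, 0 < V (x i) (y i) := fun i => by
      rw [prodChannel, ← ne_eq, Finset.prod_ne_zero_iff] at hU
      exact ((hV _).1 _).lt_of_ne (hU i (Finset.mem_univ i)).symm
    have hQi : ∀ i, 0 < outDist P V (y i) := fun i => by
      rw [prodDist, ← ne_eq, Finset.prod_ne_zero_iff] at hx
      exact (hQ.1 _).lt_of_ne fun h0 =>
        (hVi i).ne' (outDist_eq_zero hP hV (hx i (Finset.mem_univ i)) h0.symm)
    rw [Finset.prod_mul_distrib, ← Real.exp_sum, ← Finset.mul_sum]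
    -- On the tail event the exponent `t * ∑ (a - log density)` is nonnegative, so the tilting
    -- factor is at least one.
    refine le_mul_of_one_le_right ((prodChannel_mem_stdSimplex hV n x).1 y) (Real.one_le_exp ?_)
    refine mul_nonneg ht ?_
    have hUpos : 0 < prodChannel V n x y := Finset.prod_pos fun i _ => hVi i
    have hlog := Real.log_le_log hUpos hle
    have hQpos : 0 < prodDist (outDist P V) n y := Finset.prod_pos fun i _ => hQi i
    rw [Real.log_mul (by positivity) hQpos.ne', Real.log_pow,
      Real.log_exp, prodChannel, prodDist, Real.log_prod fun i _ => (hVi i).ne',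
      Real.log_prod fun i _ => (hQi i).ne'] at hlog
    simp_rw [fun i => Real.log_div (hVi i).ne' (hQi i).ne', Finset.sum_sub_distrib]
    simp only [Finset.sum_const, Finset.card_univ, Fintype.card_fin, nsmul_eq_mul]
    linarith
  · exact hnn

theorem mutualInfo_mul_log_two (P : X → ℝ) (V : X → Y → ℝ) :
    mutualInfo P V * Real.log 2
      = ∑ x, ∑ y, P x * V x y * Real.log (V x y / outDist P V y) := by
  have : Real.log 2 ≠ 0 := (Real.log_pos one_lt_two).ne'
  simp only [mutualInfo, Finset.sum_mul, Real.logb]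
  refine Finset.sum_congr rfl fun x _ => Finset.sum_congr rfl fun y _ => ?_
  field_simp

/-- The tilted moment is `1` at `t = 0` with derivative `a - I ln 2 < 0`, so it drops below `1` for
some positive `t`. -/
theorem exists_tilt_lt_one {P : X → ℝ} (hP : P ∈ stdSimplex ℝ X) {V : X → Y → ℝ}
    (hV : ∀ x, V x ∈ stdSimplex ℝ Y) {a : ℝ} (ha : a < mutualInfo P V * Real.log 2) :
    ∃ t, 0 ≤ t ∧ tilt P V a t < 1 := by
  have hsum1 : ∑ x, ∑ y, P x * V x y = 1 := by
    simp [← Finset.mul_sum, (hV _).2, hP.2]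
  have h0 : tilt P V a 0 = 1 := by simpa [tilt] using hsum1
  have hd : HasDerivAt (tilt P V a) (a - mutualInfo P V * Real.log 2) 0 := by
    have : HasDerivAt (tilt P V a) (∑ x, ∑ y, P x * (V x y * (Real.exp (0 *
        (a - Real.log (V x y / outDist P V y))) *
          (1 * (a - Real.log (V x y / outDist P V y)))))) 0 := by
      unfold tilt
      refine HasDerivAt.fun_sum fun x _ => HasDerivAt.fun_sum fun y _ => ?_
      exact ((((hasDerivAt_id (0 : ℝ)).mul_const _).exp).const_mul _).const_mul _
    convert this using 1
    rw [mutualInfo_mul_log_two]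
    have : a = ∑ x, ∑ y, P x * V x y * a := by
      simp_rw [← Finset.sum_mul]; rw [hsum1, one_mul]
    nth_rw 1 [this]
    simp only [← Finset.sum_sub_distrib]
    refine Finset.sum_congr rfl fun x _ => Finset.sum_congr rfl fun y _ => ?_
    simp; ring
  by_contra! hcon
  have hslope := (hasDerivAt_iff_tendsto_slope.mp hd).mono_left
    (nhdsWithin_mono (0 : ℝ) (fun t (ht : t ∈ Set.Ioi (0 : ℝ)) => (ne_of_gt ht : t ≠ 0)))
  have := ge_of_tendsto hslope (b := 0) (by
    filter_upwards [self_mem_nhdsWithin] with t ht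
    have ht : 0 < t := ht
    rw [slope_def_field, h0]
    exact div_nonneg (by linarith [hcon t ht.le]) (by linarith))
  linarith

/-! ### Direct part -/

open Classical in
/-- Existence of a code for a single channel with maximal error at most `ε` and output
divergence at most `δ`. -/
def HasCode (V : X → Y → ℝ) (Q : Y → ℝ) (n M K : ℕ) (ε δ : ℝ) : Prop :=
  ∃ (enc : Fin M → Fin K → (Fin n → X)) (dec : (Fin n → Y) → Fin K → Fin M),
    (∀ k m, ∑ y, (if dec y k ≠ m then prodChannel V n (enc m k) y else 0) ≤ ε) ∧
    klDivergence (fun y => (1 / ((M : ℝ) * (K : ℝ))) * ∑ m, ∑ k, prodChannel V n (enc m k) y)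
      (prodDist Q n) ≤ (δ : EReal)

theorem uniform_mixture_mem_stdSimplex {A : Type*} {U : A → Y → ℝ}
    (hU : ∀ a, U a ∈ stdSimplex ℝ Y) {M K : ℕ} (hM : 0 < M) (hK : 0 < K)
    (c : Fin M → Fin K → A) :
    (fun y => (1 / ((M : ℝ) * (K : ℝ))) * ∑ m, ∑ k, U (c m k) y) ∈ stdSimplex ℝ Y := by
  refine ⟨fun y => mul_nonneg (by positivity)
    (Finset.sum_nonneg fun m _ => Finset.sum_nonneg fun k _ => (hU _).1 y), ?_⟩
  rw [← Finset.mul_sum, Finset.sum_comm]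
  simp_rw [Finset.sum_comm (s := (Finset.univ : Finset Y)), (hU _).2]
  have : (0 : ℝ) < M := by exact_mod_cast hM
  have : (0 : ℝ) < K := by exact_mod_cast hK
  simp
  field_simp

theorem exists_pos_le {q : Y → ℝ} (hq : ∀ y, 0 ≤ q y) : ∃ β > 0, ∀ y, q y ≠ 0 → β ≤ q y := by
  have h : ∀ᶠ β in nhdsWithin (0 : ℝ) (Set.Ioi 0), ∀ y, q y ≠ 0 → β ≤ q y := by
    rw [eventually_all]
    intro y
    by_cases hy : q y = 0
    · simp [hy]
    · have : ∀ᶠ β in nhds (0 : ℝ), β < q y :=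
        eventually_lt_nhds ((hq y).lt_of_ne (Ne.symm hy))
      filter_upwards [nhdsWithin_le_nhds this] with β hβ _ using hβ.le
  obtain ⟨β, h1, h2⟩ := (h.and self_mem_nhdsWithin).exists
  exact ⟨β, h2, h1⟩

open Classical in
/-- Every set of input words of mass at least `γ` contains the codewords of a code with `M`
messages and maximal error at most `ε`. -/
def HasCodesIn (P : X → ℝ) (V : X → Y → ℝ) (n M : ℕ) (γ ε : ℝ) : Prop :=
  ∀ S : Finset (Fin n → X), γ ≤ ∑ x ∈ S, prodDist P n x →
    ∃ (c : Fin M → Fin n → X) (dec : (Fin n → Y) → Fin M), (∀ m, c m ∈ S) ∧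
      ∀ m, ∑ y, (if dec y ≠ m then prodChannel V n (c m) y else 0) ≤ ε

-- The greedy second-moment bound, normalised by `(M K)²`, is the left side of `hδ`; its base-2
-- logarithm bounds the divergence.
open Classical in
theorem hasCode_of_hasCodesIn {P : X → ℝ} (hP : P ∈ stdSimplex ℝ X) {V : X → Y → ℝ}
    (hV : ∀ x, V x ∈ stdSimplex ℝ Y) {β γ ε δ : ℝ} (hβ : 0 < β)
    (hqβ : ∀ y, outDist P V y ≠ 0 → β ≤ outDist P V y) (hγ1 : γ < 1)
    {n M K : ℕ} (hM : 0 < M) (hK : 0 < K)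
    (hgood : HasCodesIn P V n M γ ε)
    (hδ : 1 / (1 - γ) + 1 / (β ^ n * K) ≤ (2 : ℝ) ^ δ) :
    HasCode V (outDist P V) n M K ε δ := by
  have : NeZero M := ⟨hM.ne'⟩
  have hU := prodChannel_mem_stdSimplex hV n
  have hp := prodDist_mem_stdSimplex hP n
  have hq0 := (prodDist_mem_stdSimplex (outDist_mem_stdSimplex hP hV) n).1
  obtain ⟨c, d, hgd, hsupp, hchi⟩ := exists_codebooks hU hp
    (sum_prodDist_mul_prodChannel P V n) (pow_pos hβ n)
    (fun y hy => pow_le_prodDist hβ.le hqβ hy) hγ1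
    (fun (c : Fin M → Fin n → X) (dec : (Fin n → Y) → Fin M) =>
        ∀ m, ∑ y, (if dec y ≠ m then prodChannel V n (c m) y else 0) ≤ ε) hgood K
  have hM' : (0 : ℝ) < M := by exact_mod_cast hM
  have hK' : (0 : ℝ) < K := by exact_mod_cast hK
  have hac : ∀ y, prodDist (outDist P V) n y = 0 →
      (1 / ((M : ℝ) * (K : ℝ))) * ∑ m, ∑ k, prodChannel V n (c k m) y = 0 := by
    intro y hy
    refine mul_eq_zero_of_right _ (Finset.sum_eq_zero fun m _ => Finset.sum_eq_zero fun k _ => ?_)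
    rw [← sum_prodDist_mul_prodChannel, Finset.sum_eq_zero_iff_of_nonneg
      fun x _ => mul_nonneg (hp.1 x) ((hU x).1 y)] at hy
    exact (mul_eq_zero.mp (hy _ (Finset.mem_univ _))).resolve_left (hsupp k m)
  refine ⟨fun m k => c k m, fun y k => d k y, fun k m => hgd k m, ?_⟩
  rw [klDivergence, if_pos hac, EReal.coe_le_coe_iff]
  have hmix := uniform_mixture_mem_stdSimplex hU hM hK (fun m k => c k m)
  have h2 : (0 : ℝ) < 2 ^ δ := by positivity
  have hlog := sum_mul_log_div_le_log hmix hq0 hac h2 (by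
    refine le_trans (le_of_eq ?_) ((mul_le_mul_of_nonneg_left hchi
      (show 0 ≤ (1 / ((M : ℝ) * (K : ℝ))) ^ 2 by positivity)).trans (le_trans (le_of_eq ?_) hδ))
    · rw [Finset.mul_sum]
      refine Finset.sum_congr rfl fun y _ => ?_
      rw [Finset.sum_comm]
      ring
    · rw [Fintype.card_fin]
      have : 1 - γ ≠ 0 := by linarith
      field_simp)
  rw [Real.log_rpow two_pos] at hlog
  have hl2 : 0 < Real.log 2 := Real.log_pos one_lt_two
  simp only [Real.logb, ← mul_div_assoc, ← Finset.sum_div]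
  rwa [div_le_iff₀ hl2]

/-- The limit of the second moment for long keys is `1 / (1 - γ)`; strictness leaves room for the
term in `K`. -/
theorem exists_mass_level {δ : ℝ} (hδ : 0 < δ) :
    ∃ γ : ℝ, 0 < γ ∧ γ < 1 ∧ 1 / (1 - γ) < (2 : ℝ) ^ δ := by
  refine ⟨1 - (2 : ℝ) ^ (-(δ / 2)), ?_, ?_, ?_⟩
  · have : (2 : ℝ) ^ (-(δ / 2)) < 1 := Real.rpow_lt_one_of_one_lt_of_neg one_lt_two (by linarith)
    linarith
  · have : (0 : ℝ) < (2 : ℝ) ^ (-(δ / 2)) := by positivity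
    linarith
  · rw [sub_sub_cancel, Real.rpow_neg two_pos.le, one_div, inv_inv]
    exact Real.rpow_lt_rpow_of_exponent_lt one_lt_two (by linarith)

/-- One message is never confused. This covers rate zero, where the mutual information may vanish,
and small blocklengths. -/
theorem hasCodesIn_one {X : Type*} (P : X → ℝ) (V : X → Y → ℝ) (n : ℕ) {γ ε : ℝ} (hγ : 0 < γ) (hε : 0 < ε) :
    HasCodesIn P V n 1 γ ε := by
  intro S hS
  obtain ⟨x, hx⟩ : S.Nonempty := by
    rw [Finset.nonempty_iff_ne_empty]
    rintro rfl
    simp at hS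
    linarith
  refine ⟨fun _ => x, fun _ => 0, fun _ => hx, fun m => ?_⟩
  have : m = 0 := Subsingleton.elim _ _
  simpa [this] using hε.le

/-- Below the mutual information, every set of positive mass contains good codes. -/
theorem hasCodesIn_of_lt_mutualInfo {P : X → ℝ} (hP : P ∈ stdSimplex ℝ X) {V : X → Y → ℝ}
    (hV : ∀ x, V x ∈ stdSimplex ℝ Y) {γ ε R : ℝ} (hγ : 0 < γ) (hε : 0 < ε)
    (hR : R < mutualInfo P V) :
    ∀ᶠ n : ℕ in atTop, ∀ M : ℕ, 0 < M → (M : ℝ) ≤ 2 ^ (R * n) → HasCodesIn P V n M γ ε := by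
  have hl2 : 0 < Real.log 2 := Real.log_pos one_lt_two
  -- With threshold `θ = e^(a n)`, both the information-density tail and `M / θ` decay
  -- exponentially.
  obtain ⟨a, ha1, ha2⟩ := exists_between (mul_lt_mul_of_pos_right hR hl2)
  obtain ⟨t, ht0, ht1⟩ := exists_tilt_lt_one hP hV ha2
  have htn : 0 ≤ tilt P V a t := Finset.sum_nonneg fun x _ => Finset.sum_nonneg fun y _ =>
    mul_nonneg (hP.1 x) (mul_nonneg ((hV x).1 y) (Real.exp_pos _).le)
  have hX : Nonempty X := by
    by_contra hX
    rw [not_nonempty_iff] at hX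
    have := hP.2
    simp at this
  have hlim : Tendsto (fun n : ℕ => tilt P V a t ^ n + Real.exp (R * Real.log 2 - a) ^ n) atTop
      (nhds (0 + 0)) :=
    (tendsto_pow_atTop_nhds_zero_of_lt_one htn ht1).add
      (tendsto_pow_atTop_nhds_zero_of_lt_one (Real.exp_pos _).le
        (by rw [Real.exp_lt_one_iff]; linarith))
  rw [add_zero] at hlim
  filter_upwards [hlim.eventually_lt_const (mul_pos hε hγ)] with n hn M hM hMR S hS
  have hMa : (M : ℝ) / Real.exp a ^ n ≤ Real.exp (R * Real.log 2 - a) ^ n := by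
    rw [Real.exp_sub, div_pow]
    refine div_le_div_of_nonneg_right (hMR.trans (le_of_eq ?_)) (by positivity)
    rw [Real.rpow_def_of_pos two_pos, ← Real.exp_nat_mul]
    ring_nf
  obtain ⟨c, dec, h⟩ := exists_code_in (prodChannel_mem_stdSimplex hV n)
    (prodDist_mem_stdSimplex hP n).1 (sum_prodDist_mul_prodChannel P V n) (S := S)
    (pow_pos (Real.exp_pos a) n) (sum_le_tilt_pow hP hV a ht0 n) hM (lt_of_lt_of_le
      (lt_of_le_of_lt (add_le_add_right hMa _) hn) (mul_le_mul_of_nonneg_left hS hε.le))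
  exact ⟨c, dec, fun m => (h m).1, fun m => (h m).2⟩

/-- With a single message, sufficiently long keys exist at every blocklength. -/
theorem hasCode_one_message {P : X → ℝ} (hP : P ∈ stdSimplex ℝ X) {V : X → Y → ℝ}
    (hV : ∀ x, V x ∈ stdSimplex ℝ Y) {ε δ : ℝ} (hε : 0 < ε) (hδ : 0 < δ) (n : ℕ) :
    ∀ᶠ K in atTop, HasCode V (outDist P V) n 1 K ε δ := by
  obtain ⟨β, hβ, hqβ⟩ := exists_pos_le (outDist_mem_stdSimplex hP hV).1
  obtain ⟨γ, hγ0, hγ1, hγ⟩ := exists_mass_level hδ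
  have hlim : Tendsto (fun K : ℕ => 1 / (1 - γ) + 1 / (β ^ n * K)) atTop
      (nhds (1 / (1 - γ) + 0)) := by
    refine tendsto_const_nhds.add ?_
    simp_rw [one_div]
    exact tendsto_inv_atTop_zero.comp
      (tendsto_natCast_atTop_atTop.const_mul_atTop (pow_pos hβ n))
  rw [add_zero] at hlim
  filter_upwards [hlim.eventually_le_const hγ, eventually_gt_atTop 0] with K hK hK0
  exact hasCode_of_hasCodesIn hP hV hβ hqβ hγ1 one_pos hK0 (hasCodesIn_one P V n hγ0 hε) hK

/-- Rate zero and rates below the mutual information are achieved, with exponentially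
many keys. -/
theorem hasCode_of_lt_mutualInfo {P : X → ℝ} (hP : P ∈ stdSimplex ℝ X) {V : X → Y → ℝ}
    (hV : ∀ x, V x ∈ stdSimplex ℝ Y) {ε δ R : ℝ} (hε : 0 < ε) (hδ : 0 < δ)
    (hR : R = 0 ∨ R < mutualInfo P V) :
    ∃ C : ℕ, ∀ᶠ n : ℕ in atTop, ∀ M K : ℕ, 0 < M → (M : ℝ) ≤ 2 ^ (R * n) → 0 < K → C ^ n ≤ K →
      HasCode V (outDist P V) n M K ε δ := by
  obtain ⟨β, hβ, hqβ⟩ := exists_pos_le (outDist_mem_stdSimplex hP hV).1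
  obtain ⟨γ, hγ0, hγ1, hγ⟩ := exists_mass_level hδ
  -- Then `βⁿ Cⁿ ≥ 2ⁿ`, so the key term is at most `2⁻ⁿ`.
  obtain ⟨C, hC⟩ := exists_nat_ge (2 / β)
  have hlim : Tendsto (fun n : ℕ => 1 / (1 - γ) + (1 / 2 : ℝ) ^ n) atTop
      (nhds (1 / (1 - γ) + 0)) :=
    tendsto_const_nhds.add (tendsto_pow_atTop_nhds_zero_of_lt_one (by norm_num) (by norm_num))
  rw [add_zero] at hlim
  have hcodes : ∀ᶠ n : ℕ in atTop, ∀ M : ℕ, 0 < M → (M : ℝ) ≤ 2 ^ (R * n) →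
      HasCodesIn P V n M γ ε := by
    rcases hR with rfl | hR
    · refine Eventually.of_forall fun n M hM hM1 => ?_
      rw [zero_mul, Real.rpow_zero] at hM1
      obtain rfl : M = 1 := le_antisymm (by exact_mod_cast hM1) hM
      exact hasCodesIn_one P V n hγ0 hε
    · exact hasCodesIn_of_lt_mutualInfo hP hV hγ0 hε hR
  refine ⟨C, ?_⟩
  filter_upwards [hlim.eventually_le_const hγ, hcodes] with n h1 h2 M K hM hMR hK hCK
  refine hasCode_of_hasCodesIn hP hV hβ hqβ hγ1 hM hK (h2 M hM hMR) (le_trans ?_ h1)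
  refine add_le_add_right ?_ _
  have hCK' : (C : ℝ) ^ n ≤ K := by exact_mod_cast hCK
  have h3 : (2 : ℝ) ^ n ≤ β ^ n * K := by
    calc (2 : ℝ) ^ n = β ^ n * (2 / β) ^ n := by rw [← mul_pow]; congr 1; field_simp
      _ ≤ β ^ n * (C : ℝ) ^ n := by gcongr
      _ ≤ _ := by gcongr
  rw [one_div_pow]
  gcongr

theorem exists_isKLCode {X : Type*} {W : Fin 2 → X → Y → ℝ} {Q₀ : Y → ℝ} {ε : ℝ} {δ : Fin 2 → ℝ}
    {n M K : ℕ} (h : ∀ s, HasCode (W s) Q₀ n M K ε (δ s)) :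
    ∃ c : Code X Y n M K, c.IsKLCode W Q₀ ε δ := by
  choose enc dec h1 h2 using h
  exact ⟨⟨enc, dec⟩, h1, h2⟩

/-- Codes for all large blocklengths can be completed to a sequence of codes. -/
theorem exists_isAchievable {X : Type*} {W : Fin 2 → X → Y → ℝ} {Q₀ : Y → ℝ} {ε : ℝ} {δ : Fin 2 → ℝ}
    {L : ℝ} {M : ℕ → ℕ} (hM : ∀ n, 0 < M n) {C : ℕ} (hC : 0 < C)
    (hone : ∀ n, ∀ᶠ K in atTop, ∀ s, HasCode (W s) Q₀ n 1 K ε (δ s))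
    (hcode : ∀ᶠ n in atTop, ∀ s, HasCode (W s) Q₀ n (M n) (C ^ n) ε (δ s))
    (hL : (L : EReal) ≤
      liminf (fun n : ℕ => ((Real.logb 2 (M n) / (n : ℝ) ^ (1 : ℝ) : ℝ) : EReal)) atTop) :
    ∃ LK : ℝ, 0 ≤ LK ∧ IsAchievable W Q₀ 1 ε δ L (LK : EReal) := by
  obtain ⟨n₀, hn₀⟩ := eventually_atTop.mp hcode
  -- Achievability asks for a code at every `n`; below `n₀` one message with a long key fills the
  -- gap without affecting the limits.
  have key : ∀ n, ∃ (M' K' : ℕ) (c : Code X Y n M' K'), 0 < M' ∧ 0 < K' ∧ c.IsKLCode W Q₀ ε δ ∧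
      (n₀ ≤ n → M' = M n ∧ K' = C ^ n) := by
    intro n
    by_cases hn : n₀ ≤ n
    · obtain ⟨c, hc⟩ := exists_isKLCode (hn₀ n hn)
      exact ⟨M n, C ^ n, c, hM n, pow_pos hC n, hc, fun _ => ⟨rfl, rfl⟩⟩
    · obtain ⟨K, hK, hK0⟩ := ((hone n).and (eventually_gt_atTop 0)).exists
      obtain ⟨c, hc⟩ := exists_isKLCode hK
      exact ⟨1, K, c, one_pos, hK0, hc, fun h => absurd h hn⟩
  choose M' K' c h1 h2 h3 h4 using key
  refine ⟨Real.logb 2 C, Real.logb_nonneg one_lt_two (by exact_mod_cast hC), M', K', c,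
    fun n => ⟨h1 n, h2 n, h3 n⟩, hL.trans (le_of_eq (liminf_congr ?_)), ?_⟩
  · filter_upwards [eventually_ge_atTop n₀] with n hn
    rw [(h4 n hn).1]
  · refine le_of_eq ((limsup_congr ?_).trans (limsup_const ((Real.logb 2 C : ℝ) : EReal)))
    filter_upwards [eventually_ge_atTop n₀, eventually_gt_atTop 0] with n hn hn0
    have : (n : ℝ) ≠ 0 := by exact_mod_cast hn0.ne'
    rw [(h4 n hn).2, Nat.cast_pow, Real.logb_pow, Real.rpow_one, mul_div_cancel_left₀ _ this]

theorem le_liminf_logb_floor {L : ℝ} (hL : 0 ≤ L) :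
    (L : EReal) ≤ liminf (fun n : ℕ =>
      ((Real.logb 2 (⌊(2 : ℝ) ^ (L * n)⌋₊ : ℕ) / (n : ℝ) ^ (1 : ℝ) : ℝ) : EReal)) atTop := by
  have hlim : Tendsto (fun n : ℕ => ((L - 1 / (n : ℝ) : ℝ) : EReal)) atTop (nhds (L : EReal)) := by
    refine (continuous_coe_real_ereal.tendsto L).comp ?_
    simpa using (tendsto_const_nhds (x := L)).sub tendsto_one_div_atTop_nhds_zero_nat
  rw [← hlim.liminf_eq]
  refine liminf_le_liminf ?_
  filter_upwards [eventually_gt_atTop 0] with n hn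
  have hn' : (0 : ℝ) < n := by exact_mod_cast hn
  rw [EReal.coe_le_coe_iff, Real.rpow_one, le_div_iff₀ hn', sub_mul, one_div_mul_cancel hn'.ne']
  have h1 : (1 : ℝ) ≤ 2 ^ (L * n) := Real.one_le_rpow one_le_two (by positivity)
  -- Rounding down loses at most a factor two, hence one bit.
  have h2 : (2 : ℝ) ^ (L * n - 1) ≤ (⌊(2 : ℝ) ^ (L * n)⌋₊ : ℕ) := by
    have h3 := Nat.lt_floor_add_one ((2 : ℝ) ^ (L * n))
    have h4 : (1 : ℝ) ≤ (⌊(2 : ℝ) ^ (L * n)⌋₊ : ℕ) := by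
      exact_mod_cast Nat.le_floor (by exact_mod_cast h1)
    rw [Real.rpow_sub_one two_ne_zero]
    linarith
  have h5 := Real.logb_le_logb_of_le one_lt_two (by positivity) h2
  rwa [Real.logb_rpow two_pos (by norm_num)] at h5

/-- Direct part: rate zero and all rates below both mutual informations are achievable. -/
theorem exists_isAchievable_of_lt {W : Fin 2 → X → Y → ℝ} (hW : ∀ s x, W s x ∈ stdSimplex ℝ Y)
    {Q₀ : Y → ℝ} {P : Fin 2 → X → ℝ} (hP : P ∈ maskingPairs W Q₀) {ε : ℝ} (hε : 0 < ε)
    {δ : Fin 2 → ℝ} (hδ : ∀ s, 0 < δ s) {L : ℝ} (hL0 : 0 ≤ L)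
    (hL : ∀ s, L = 0 ∨ L < mutualInfo (P s) (W s)) :
    ∃ LK : ℝ, 0 ≤ LK ∧ IsAchievable W Q₀ 1 ε δ L (LK : EReal) := by
  have hQ : ∀ s, outDist (P s) (W s) = Q₀ := fun s => funext (hP.2 s)
  have hone : ∀ n, ∀ᶠ K in atTop, ∀ s, HasCode (W s) Q₀ n 1 K ε (δ s) := by
    intro n
    rw [eventually_all]
    intro s
    rw [← hQ s]
    exact hasCode_one_message (hP.1 s) (hW s) hε (hδ s) n
  choose C hC using fun s => hasCode_of_lt_mutualInfo (hP.1 s) (hW s) hε (hδ s) (hL s)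
  have hMpos : ∀ n : ℕ, 0 < ⌊(2 : ℝ) ^ (L * n)⌋₊ := fun n =>
    Nat.floor_pos.mpr (Real.one_le_rpow one_le_two (by positivity))
  -- Both states share one key set, so the key base must dominate `C 0` and `C 1` and be positive.
  refine exists_isAchievable hMpos (Nat.succ_pos (C 0 + C 1)) hone ?_ (le_liminf_logb_floor hL0)
  filter_upwards [eventually_all.mpr hC] with n hn s
  rw [← hQ s]
  refine hn s _ _ (hMpos n) (Nat.floor_le (by positivity)) (by positivity)
    (Nat.pow_le_pow_left ?_ n)
  fin_cases s <;> simp <;> omega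

/-! ### Converse part -/

/-- Linearity of expectation. It single-letterises both the divergence and the letter counts. -/
theorem sum_pi_prod_mul_sum {Z : Type*} [Fintype Z] {n : ℕ} {p : Fin n → Z → ℝ}
    (hp : ∀ i, ∑ z, p i z = 1) (f : Fin n → Z → ℝ) :
    ∑ z : Fin n → Z, (∏ i, p i (z i)) * ∑ i, f i (z i) = ∑ i, ∑ z, p i z * f i z := by
  simp_rw [Finset.mul_sum]
  rw [Finset.sum_comm]
  refine Finset.sum_congr rfl fun i _ => ?_
  have h : ∀ z : Fin n → Z, (∏ j, p j (z j)) * f i (z i)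
      = ∏ j, (p j (z j) * if j = i then f i (z j) else 1) := by
    intro z
    rw [Finset.prod_mul_distrib, Finset.prod_ite_eq' Finset.univ i (fun j => f i (z j))]
    simp
  simp_rw [h]
  rw [sum_pi_prod (fun j z => p j z * if j = i then f i z else 1),
    Finset.prod_eq_single i (fun j _ hj => by simp [hj, hp j]) (by simp)]
  simp

/-- Divergence in nats of a row of the channel from the output distribution `Q`. -/
def rowDiv (V : X → Y → ℝ) (Q : Y → ℝ) (x : X) : ℝ :=
  ∑ y, V x y * Real.log (V x y / Q y)

theorem sum_prodChannel_mul_log {X : Type*} {V : X → Y → ℝ} (hV : ∀ x, V x ∈ stdSimplex ℝ Y)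
    {Q : Y → ℝ} {n : ℕ} {x : Fin n → X} (hac : ∀ i y, Q y = 0 → V (x i) y = 0) :
    ∑ y, prodChannel V n x y * Real.log (prodChannel V n x y / prodDist Q n y)
      = ∑ i, rowDiv V Q (x i) := by
  simp only [rowDiv]
  rw [← sum_pi_prod_mul_sum (p := fun i => V (x i)) (fun i => (hV (x i)).2)
    (fun i y => Real.log (V (x i) y / Q y))]
  refine Finset.sum_congr rfl fun y _ => ?_
  by_cases h0 : prodChannel V n x y = 0
  · rw [h0, zero_mul]
    rw [prodChannel] at h0
    rw [h0, zero_mul]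
  · rw [prodChannel, prodDist, ← Finset.prod_div_distrib, Real.log_prod]
    intro i _
    rw [prodChannel, ← ne_eq, Finset.prod_ne_zero_iff] at h0
    have := h0 i (Finset.mem_univ i)
    exact div_ne_zero this fun hQ => this (hac i _ hQ)

theorem eq_zero_of_prodChannel {X : Type*} {V : X → Y → ℝ} (hV : ∀ x, V x ∈ stdSimplex ℝ Y)
    {Q : Y → ℝ} {n : ℕ} {x : Fin n → X}
    (hac : ∀ y, prodDist Q n y = 0 → prodChannel V n x y = 0) (i : Fin n) (y : Y) (hy : Q y = 0) :
    V (x i) y = 0 := by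
  by_contra hne
  have hex : ∀ j, ∃ y, V (x j) y ≠ 0 := fun j => by
    by_contra! h0
    have := (hV (x j)).2
    simp [h0] at this
  choose w hw using hex
  -- The other coordinates carry letters of positive probability, so only the factor at `i` can
  -- vanish.
  have h1 : prodDist Q n (Function.update w i y) = 0 :=
    Finset.prod_eq_zero (Finset.mem_univ i) (by simpa using hy)
  have h2 := hac _ h1
  rw [prodChannel, Finset.prod_eq_zero_iff] at h2
  obtain ⟨j, -, hj⟩ := h2
  by_cases hji : j = i
  · subst hji
    simp [hne] at hj
  · rw [Function.update_of_ne hji] at hj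
    exact hw j hj

open Classical in
/-- The average single-letter input distribution of a family of codewords. -/
theorem exists_average_input {M K n : ℕ} (hM : 0 < M) (hK : 0 < K) (hn : 0 < n)
    (enc : Fin M → Fin K → Fin n → X) :
    ∃ P ∈ stdSimplex ℝ X, ∀ f : X → ℝ,
      ∑ x, P x * f x = (1 / ((M : ℝ) * K * n)) * ∑ m, ∑ k, ∑ i, f (enc m k i) := by
  have hf : ∀ f : X → ℝ,
      ∑ x, ((1 / ((M : ℝ) * K * n)) * ∑ m, ∑ k, ∑ i, if enc m k i = x then (1 : ℝ) else 0) * f x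
        = (1 / ((M : ℝ) * K * n)) * ∑ m, ∑ k, ∑ i, f (enc m k i) := by
    intro f
    simp_rw [mul_assoc (1 / ((M : ℝ) * K * n)), ← Finset.mul_sum, Finset.sum_mul]
    rw [Finset.sum_comm]
    simp_rw [Finset.sum_comm (s := (Finset.univ : Finset X))]
    simp
  refine ⟨_, ⟨fun x => ?_, ?_⟩, hf⟩
  · refine mul_nonneg (by positivity) (Finset.sum_nonneg fun m _ => Finset.sum_nonneg fun k _ =>
      Finset.sum_nonneg fun i _ => ?_)
    split_ifs <;> simp
  · have h1 := hf fun _ => 1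
    simp only [mul_one] at h1
    rw [h1]
    have : (0 : ℝ) < M := by exact_mod_cast hM
    have : (0 : ℝ) < K := by exact_mod_cast hK
    have : (0 : ℝ) < n := by exact_mod_cast hn
    simp
    field_simp

open Classical in
/-- Meta-converse for the codewords of a single key: the logarithm of the number of messages is
bounded by the average divergence of the codewords from an arbitrary product distribution. -/
theorem log_card_le_sum_rowDiv {X : Type*} {V : X → Y → ℝ} (hV : ∀ x, V x ∈ stdSimplex ℝ Y)
    {Q : Y → ℝ} (hQ : Q ∈ stdSimplex ℝ Y) {n M : ℕ} (hM : 0 < M) {ε : ℝ} (c : Fin M → Fin n → X)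
    (dec : (Fin n → Y) → Fin M) (hac : ∀ m i y, Q y = 0 → V (c m i) y = 0)
    (herr : ∀ m, ∑ y, (if dec y ≠ m then prodChannel V n (c m) y else 0) ≤ ε) :
    M * ((1 - ε) * Real.log M - 1) ≤ ∑ m, ∑ i, rowDiv V Q (c m i) := by
  have hM1 : (1 : ℝ) ≤ M := by exact_mod_cast hM
  have hlog : 0 ≤ Real.log M := Real.log_nonneg hM1
  have hQn := prodDist_mem_stdSimplex hQ n
  have key : ∀ m, (1 - ε) * Real.log M ≤ ∑ i, rowDiv V Q (c m i)
      + M * ∑ y, (if dec y = m then prodDist Q n y else 0) := by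
    intro m
    have hU := prodChannel_mem_stdSimplex hV n (c m)
    have hacm : ∀ y, prodDist Q n y = 0 → prodChannel V n (c m) y = 0 := by
      intro y hy
      rw [prodDist, Finset.prod_eq_zero_iff] at hy
      obtain ⟨i, hi, hy⟩ := hy
      exact Finset.prod_eq_zero hi (hac m i _ hy)
    have hdv := sum_mul_le_klDiv_add_log hU hQn.1 hacm
      (fun y => if dec y = m then Real.log M else 0)
    rw [sum_prodChannel_mul_log hV (hac m)] at hdv
    have hleft : (1 - ε) * Real.log M
        ≤ ∑ y, prodChannel V n (c m) y * (if dec y = m then Real.log M else 0) := by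
      have hs : ∑ y, (if dec y = m then prodChannel V n (c m) y else 0)
          + ∑ y, (if dec y ≠ m then prodChannel V n (c m) y else 0) = 1 := by
        rw [← hU.2, ← Finset.sum_add_distrib]
        exact Finset.sum_congr rfl fun y _ => by split_ifs <;> simp_all
      calc (1 - ε) * Real.log M
          ≤ (∑ y, (if dec y = m then prodChannel V n (c m) y else 0)) * Real.log M :=
            mul_le_mul_of_nonneg_right (by linarith [herr m]) hlog
        _ = _ := by
            rw [Finset.sum_mul]
            exact Finset.sum_congr rfl fun y _ => by split_ifs <;> simp
    have hright : Real.log (∑ y, prodDist Q n y *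
          Real.exp (if dec y = m then Real.log M else 0))
        ≤ M * ∑ y, (if dec y = m then prodDist Q n y else 0) := by
      have hle : ∑ y, prodDist Q n y * Real.exp (if dec y = m then Real.log M else 0)
          ≤ 1 + M * ∑ y, (if dec y = m then prodDist Q n y else 0) := by
        rw [← hQn.2, Finset.mul_sum, ← Finset.sum_add_distrib]
        refine Finset.sum_le_sum fun y _ => ?_
        have := hQn.1 y
        split_ifs
        · rw [Real.exp_log (by linarith)]; linarith
        · simp
      have hpos : 0 < ∑ y, prodDist Q n y * Real.exp (if dec y = m then Real.log M else 0) := by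
        have : ∑ y, prodDist Q n y
            ≤ ∑ y, prodDist Q n y * Real.exp (if dec y = m then Real.log M else 0) := by
          refine Finset.sum_le_sum fun y _ => le_mul_of_one_le_right (hQn.1 y) ?_
          refine Real.one_le_exp ?_
          split_ifs <;> simp [hlog]
        rw [hQn.2] at this
        linarith
      have := Real.log_le_sub_one_of_pos hpos
      linarith
    linarith
  have hsum := Finset.sum_le_sum fun m (_ : m ∈ Finset.univ) => key m
  -- Decoding sets partition the output space; this total mass is the source of the `- 1`.
  have hone : ∑ m, ∑ y, (if dec y = m then prodDist Q n y else 0) = 1 := by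
    rw [Finset.sum_comm]
    simp [hQn.2]
  rw [Finset.sum_add_distrib, ← Finset.mul_sum (s := Finset.univ) (a := (M : ℝ)), hone] at hsum
  simp only [Finset.sum_const, Finset.card_univ, Fintype.card_fin, nsmul_eq_mul] at hsum
  linarith

open Classical in
/-- Small divergence from a product distribution controls the average single-letter marginals. -/
theorem sum_marginal_le {n : ℕ} {p : (Fin n → Y) → ℝ} (hp : p ∈ stdSimplex ℝ (Fin n → Y))
    {Q : Y → ℝ} (hQ : Q ∈ stdSimplex ℝ Y) (hac : ∀ y, prodDist Q n y = 0 → p y = 0) {D : ℝ}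
    (hD : ∑ y, p y * Real.log (p y / prodDist Q n y) ≤ D) (y₀ : Y) {t : ℝ} (ht : 0 ≤ t) :
    t * ∑ y, p y * ∑ i, (if y i = y₀ then 1 else 0) ≤ D + n * (Q y₀ * (Real.exp t - 1)) := by
  have hdv := sum_mul_le_klDiv_add_log hp (prodDist_mem_stdSimplex hQ n).1 hac
    (fun y => t * ∑ i, (if y i = y₀ then (1 : ℝ) else 0))
  have hmgf : ∑ y, prodDist Q n y * Real.exp (t * ∑ i, (if y i = y₀ then (1 : ℝ) else 0))
      = (1 + Q y₀ * (Real.exp t - 1)) ^ n := by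
    have h1 : ∀ y : Fin n → Y,
        prodDist Q n y * Real.exp (t * ∑ i, (if y i = y₀ then (1 : ℝ) else 0))
        = ∏ i, (Q (y i) * Real.exp (t * if y i = y₀ then (1 : ℝ) else 0)) := by
      intro y
      rw [Finset.mul_sum, Real.exp_sum, prodDist, Finset.prod_mul_distrib]
    simp_rw [h1]
    rw [sum_pi_prod (fun _ y => Q y * Real.exp (t * if y = y₀ then (1 : ℝ) else 0))]
    have h2 : ∀ y, Q y * Real.exp (t * if y = y₀ then (1 : ℝ) else 0)
        = Q y + if y = y₀ then Q y * (Real.exp t - 1) else 0 := by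
      intro y; split_ifs <;> simp; ring
    simp_rw [h2]
    simp [Finset.sum_add_distrib, hQ.2]
  have hexp : 1 ≤ Real.exp t := Real.one_le_exp ht
  have hpos : 0 < 1 + Q y₀ * (Real.exp t - 1) := by
    have := mul_nonneg (hQ.1 y₀) (sub_nonneg.mpr hexp)
    linarith
  rw [hmgf, Real.log_pow] at hdv
  have hl := mul_le_mul_of_nonneg_left (Real.log_le_sub_one_of_pos hpos) (Nat.cast_nonneg (α := ℝ) n)
  calc t * ∑ y, p y * ∑ i, (if y i = y₀ then (1 : ℝ) else 0)
      = ∑ y, p y * (t * ∑ i, (if y i = y₀ then (1 : ℝ) else 0)) := by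
        rw [Finset.mul_sum]; exact Finset.sum_congr rfl fun y _ => by ring
    _ ≤ _ := by linarith

/-- Single-letter constraints satisfied by the average input distribution of a code. -/
theorem Code.IsKLCode.exists_input {W : Fin 2 → X → Y → ℝ} (hW : ∀ s x, W s x ∈ stdSimplex ℝ Y)
    {Q₀ : Y → ℝ} (hQ : Q₀ ∈ stdSimplex ℝ Y) {ε : ℝ} {δ : Fin 2 → ℝ} {n M K : ℕ}
    {c : Code X Y n M K} (hc : c.IsKLCode W Q₀ ε δ) (hM : 0 < M) (hK : 0 < K) (hn : 0 < n)
    (s : Fin 2) :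
    ∃ P ∈ stdSimplex ℝ X,
      (1 - ε) * (Real.log M / n) ≤ ∑ x, P x * rowDiv (W s) Q₀ x + 1 / n ∧
      ∀ y t, 0 ≤ t → t * outDist P (W s) y
        ≤ δ s * Real.log 2 * (1 / n) + Q₀ y * (Real.exp t - 1) := by
  classical
  have hM' : (0 : ℝ) < M := by exact_mod_cast hM
  have hK' : (0 : ℝ) < K := by exact_mod_cast hK
  have hn' : (0 : ℝ) < n := by exact_mod_cast hn
  have hl2 : 0 < Real.log 2 := Real.log_pos one_lt_two
  have hU := prodChannel_mem_stdSimplex (hW s) n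
  obtain ⟨herr, hkl⟩ := hc
  have hkl := hkl s
  have hout : c.output W s ∈ stdSimplex ℝ (Fin n → Y) :=
    uniform_mixture_mem_stdSimplex hU hM hK (c.enc s)
  -- Otherwise the divergence would be `⊤`, against the finite bound.
  have hac : ∀ y, prodDist Q₀ n y = 0 → c.output W s y = 0 := by
    by_contra hcon
    rw [klDivergence, if_neg hcon] at hkl
    exact absurd hkl (by simp)
  rw [klDivergence, if_pos hac, EReal.coe_le_coe_iff] at hkl
  have hkl' : ∑ y, c.output W s y * Real.log (c.output W s y / prodDist Q₀ n y)
      ≤ δ s * Real.log 2 := by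
    rw [← div_le_iff₀ hl2, Finset.sum_div]
    simpa only [Real.logb, mul_div_assoc] using hkl
  have hacx : ∀ m k i y, Q₀ y = 0 → W s (c.enc s m k i) y = 0 := by
    intro m k
    refine eq_zero_of_prodChannel (hW s) (x := c.enc s m k) fun y hy => ?_
    have h0 := hac y hy
    rw [Code.output, mul_eq_zero] at h0
    have h1 := h0.resolve_left (by positivity)
    rw [Finset.sum_eq_zero_iff_of_nonneg
      fun m _ => Finset.sum_nonneg fun k _ => (hU _).1 y] at h1
    have h2 := h1 m (Finset.mem_univ m)
    rw [Finset.sum_eq_zero_iff_of_nonneg fun k _ => (hU _).1 y] at h2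
    exact h2 k (Finset.mem_univ k)
  obtain ⟨P, hP, hPf⟩ := exists_average_input hM hK hn (c.enc s)
  refine ⟨P, hP, ?_, fun y t ht => ?_⟩
  · rw [hPf]
    have h1 : ∀ k, M * ((1 - ε) * Real.log M - 1)
        ≤ ∑ m, ∑ i, rowDiv (W s) Q₀ (c.enc s m k i) := fun k =>
      log_card_le_sum_rowDiv (hW s) hQ hM (fun m => c.enc s m k) (fun y => c.dec s y k)
        (fun m i y hy => hacx m k i y hy) (fun m => by
          have := herr s k m
          simpa only [Code.errorProb] using this)
    have h2 := Finset.sum_le_sum fun k (_ : k ∈ Finset.univ) => h1 k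
    rw [Finset.sum_comm] at h2
    simp only [Finset.sum_const, Finset.card_univ, Fintype.card_fin, nsmul_eq_mul] at h2
    have h3 := mul_le_mul_of_nonneg_left h2 (show 0 ≤ 1 / ((M : ℝ) * K * n) by positivity)
    have h4 : 1 / ((M : ℝ) * K * n) * (K * (M * ((1 - ε) * Real.log M - 1)))
        = (1 - ε) * (Real.log M / n) - 1 / n := by
      field_simp
    linarith
  · have h1 := sum_marginal_le hout hQ hac hkl' y ht
    have h2 : ∑ z, c.output W s z * ∑ i, (if z i = y then (1 : ℝ) else 0)
        = n * outDist P (W s) y := by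
      have h3 : ∀ m k, ∑ z, prodChannel (W s) n (c.enc s m k) z *
          ∑ i, (if z i = y then (1 : ℝ) else 0) = ∑ i, W s (c.enc s m k i) y := by
        intro m k
        simp only [prodChannel]
        rw [sum_pi_prod_mul_sum (p := fun i => W s (c.enc s m k i)) (fun i => (hW _ _).2)
          (fun _ z => if z = y then (1 : ℝ) else 0)]
        simp
      rw [outDist, hPf fun x => W s x y]
      simp_rw [← h3, Code.output, mul_assoc (1 / ((M : ℝ) * K)), ← Finset.mul_sum, Finset.sum_mul]
      rw [Finset.sum_comm]
      simp_rw [Finset.sum_comm (s := (Finset.univ : Finset (Fin n → Y)))]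
      field_simp
    rw [h2] at h1
    have h4 : t * outDist P (W s) y = (t * (n * outDist P (W s) y)) * (1 / n) := by field_simp
    have h5 : δ s * Real.log 2 * (1 / n) + Q₀ y * (Real.exp t - 1)
        = (δ s * Real.log 2 + n * (Q₀ y * (Real.exp t - 1))) * (1 / n) := by field_simp
    rw [h4, h5]
    exact mul_le_mul_of_nonneg_right h1 (by positivity)

/-- Once the output is pinned to `Q`, information is linear in `P`; this gives both its continuity
on `maskingPairs` and the passage to the limit in the converse. -/
theorem mutualInfo_mul_log_two_eq_sum_rowDiv {P : X → ℝ} {V : X → Y → ℝ} {Q : Y → ℝ}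
    (h : ∀ y, outDist P V y = Q y) :
    mutualInfo P V * Real.log 2 = ∑ x, P x * rowDiv V Q x := by
  rw [mutualInfo_mul_log_two]
  simp only [rowDiv, h, Finset.mul_sum, mul_assoc]

/-- Converse part. -/
theorem IsAchievable.exists_mutualInfo_ge {W : Fin 2 → X → Y → ℝ}
    (hW : ∀ s x, W s x ∈ stdSimplex ℝ Y) {Q₀ : Y → ℝ} (hQ : Q₀ ∈ stdSimplex ℝ Y) {ε : ℝ}
    (hε : ε < 1) {δ : Fin 2 → ℝ} {L : ℝ} {LK : EReal} (h : IsAchievable W Q₀ 1 ε δ L LK)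
    (s : Fin 2) :
    ∃ P ∈ stdSimplex ℝ X, (∀ y, outDist P (W s) y = Q₀ y) ∧
      (1 - ε) * L ≤ mutualInfo P (W s) := by
  obtain ⟨M, K, c, hc, hL, -⟩ := h
  have hl2 : 0 < Real.log 2 := Real.log_pos one_lt_two
  -- The shift to `n + 1` avoids blocklength zero.
  choose P hP hPM hPQ using fun n : ℕ => (hc (n + 1)).2.2.exists_input hW hQ (hc (n + 1)).1
    (hc (n + 1)).2.1 n.succ_pos s
  obtain ⟨P', hP', φ, hφ, hlim⟩ := (isCompact_stdSimplex ℝ X).tendsto_subseq hP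
  have hlimx : ∀ x, Tendsto (fun j => P (φ j) x) atTop (nhds (P' x)) := fun x =>
    (tendsto_pi_nhds.mp hlim) x
  have hlin : ∀ f : X → ℝ, Tendsto (fun j => ∑ x, P (φ j) x * f x) atTop
      (nhds (∑ x, P' x * f x)) := fun f =>
    tendsto_finsetSum _ fun x _ => (hlimx x).mul_const _
  have hinv : Tendsto (fun j => (1 : ℝ) / ((φ j + 1 : ℕ) : ℝ)) atTop (nhds 0) :=
    (tendsto_one_div_atTop_nhds_zero_nat (𝕜 := ℝ)).comp
      ((tendsto_add_atTop_nat 1).comp hφ.tendsto_atTop)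
  have hle : ∀ y, outDist P' (W s) y ≤ Q₀ y := by
    intro y
    have h1 : ∀ t, 0 ≤ t → t * outDist P' (W s) y ≤ Q₀ y * (Real.exp t - 1) := by
      intro t ht
      have := le_of_tendsto_of_tendsto' ((hlin fun x => W s x y).const_mul t)
        ((hinv.const_mul (δ s * Real.log 2)).add_const (Q₀ y * (Real.exp t - 1)))
        (fun j => hPQ (φ j) y t ht)
      simpa [outDist] using this
    -- Dividing by `t` and letting `t` decrease to zero turns `(e^t - 1) / t` into `1`.
    have hslope := (hasDerivAt_iff_tendsto_slope.mp (Real.hasDerivAt_exp 0)).mono_left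
      (nhdsWithin_mono (0 : ℝ) (fun t (ht : t ∈ Set.Ioi (0 : ℝ)) => (ne_of_gt ht : t ≠ 0)))
    have := ge_of_tendsto (hslope.const_mul (Q₀ y)) (b := outDist P' (W s) y) (by
      filter_upwards [self_mem_nhdsWithin] with t ht
      have ht : 0 < t := ht
      rw [slope_def_field, Real.exp_zero, sub_zero, ← mul_div_assoc, le_div_iff₀ ht, mul_comm]
      exact h1 t ht.le)
    simpa using this
  -- Both sides have total mass one, so the pointwise inequality is an equality.
  have heq : ∀ y, outDist P' (W s) y = Q₀ y := by
    have := (Finset.sum_eq_sum_iff_of_le fun y (_ : y ∈ Finset.univ) => hle y).mp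
      ((outDist_mem_stdSimplex hP' (hW s)).2.trans hQ.2.symm)
    exact fun y => this y (Finset.mem_univ y)
  refine ⟨P', hP', heq, ?_⟩
  have hlt : ∀ L' < L, (1 - ε) * L' ≤ mutualInfo P' (W s) := by
    intro L' hL'
    have hev := eventually_lt_of_lt_liminf
      (lt_of_lt_of_le (EReal.coe_lt_coe_iff.mpr hL') hL)
    have hev' := ((tendsto_add_atTop_nat 1).comp hφ.tendsto_atTop).eventually hev
    have := le_of_tendsto_of_tendsto (tendsto_const_nhds (x := (1 - ε) * L' * Real.log 2))
      ((hlin (rowDiv (W s) Q₀)).add hinv) (by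
        filter_upwards [hev'] with j hj
        refine le_trans ?_ (hPM (φ j))
        simp only [Function.comp] at hj
        rw [EReal.coe_lt_coe_iff, Real.rpow_one, Real.logb] at hj
        rw [mul_assoc]
        refine mul_le_mul_of_nonneg_left ?_ (by linarith)
        rw [← le_div_iff₀ hl2]
        refine hj.le.trans (le_of_eq ?_)
        ring)
    rw [add_zero, ← mutualInfo_mul_log_two_eq_sum_rowDiv heq] at this
    exact le_of_mul_le_mul_right this hl2
  have hcont : Tendsto (fun L' => (1 - ε) * L') (nhdsWithin L (Set.Iio L)) (nhds ((1 - ε) * L)) :=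
    ((continuous_const.mul continuous_id).tendsto L).mono_left nhdsWithin_le_nhds
  exact le_of_tendsto hcont (by filter_upwards [self_mem_nhdsWithin] with L' hL' using hlt L' hL')

/-! ### Positivity, compactness and the limit in `ε` -/

/-- Up to `ln 2`, information is the `P`-average of row divergences from the output, which are
nonnegative on the support. Two different rows cannot both equal the output, so one term is strictly
positive. -/
theorem mutualInfo_pos {P : X → ℝ} (hP : P ∈ stdSimplex ℝ X) {V : X → Y → ℝ}
    (hV : ∀ x, V x ∈ stdSimplex ℝ Y) {x x' : X} (hx : P x ≠ 0) (hx' : P x' ≠ 0)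
    (hne : V x ≠ V x') : 0 < mutualInfo P V := by
  have hQ := outDist_mem_stdSimplex hP hV
  obtain ⟨x₀, hx₀, hne₀⟩ : ∃ x₀, P x₀ ≠ 0 ∧ V x₀ ≠ outDist P V := by
    by_contra! hcon
    exact hne ((hcon x hx).trans (hcon x' hx').symm)
  refine pos_of_mul_pos_left ?_ (Real.log_pos one_lt_two).le
  rw [mutualInfo_mul_log_two_eq_sum_rowDiv (Q := outDist P V) fun _ => rfl]
  have hle : ∀ x, P x ≠ 0 → 0 ≤ rowDiv V (outDist P V) x := by
    intro x hx
    have := Finset.sum_le_sum fun y (_ : y ∈ Finset.univ) =>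
      sub_le_mul_log_div ((hV x).1 y) (hQ.1 y) (outDist_eq_zero hP hV hx)
    rwa [Finset.sum_sub_distrib, (hV x).2, hQ.2, sub_self] at this
  refine Finset.sum_pos' (fun x _ => ?_) ⟨x₀, Finset.mem_univ _, ?_⟩
  · by_cases hx : P x = 0
    · simp [hx]
    · exact mul_nonneg (hP.1 x) (hle x hx)
  · refine mul_pos ((hP.1 x₀).lt_of_ne hx₀.symm) ?_
    obtain ⟨y, hy⟩ := Function.ne_iff.mp hne₀
    have := Finset.sum_lt_sum (fun y (_ : y ∈ Finset.univ) =>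
      sub_le_mul_log_div ((hV x₀).1 y) (hQ.1 y) (outDist_eq_zero hP hV hx₀))
      ⟨y, Finset.mem_univ y, sub_lt_mul_log_div ((hV x₀).1 y) (hQ.1 y)
        (outDist_eq_zero hP hV hx₀) hy⟩
    rwa [Finset.sum_sub_distrib, (hV x₀).2, hQ.2, sub_self] at this

theorem exists_ne_of_mutualInfo_pos {P : X → ℝ} (hP : P ∈ stdSimplex ℝ X) {V : X → Y → ℝ}
    (h : 0 < mutualInfo P V) : ∃ x x', P x ≠ 0 ∧ P x' ≠ 0 ∧ V x ≠ V x' := by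
  by_contra! hcon
  refine h.ne' (Finset.sum_eq_zero fun x _ => Finset.sum_eq_zero fun y _ => ?_)
  by_cases hx : P x = 0
  · simp [hx]
  have hout : outDist P V y = V x y := by
    have : ∀ x', P x' * V x' y = P x' * V x y := fun x' => by
      by_cases hx' : P x' = 0
      · simp [hx']
      · rw [hcon x' x hx' hx]
    simp [outDist, this, ← Finset.sum_mul, hP.2]
  rw [hout]
  by_cases hy : V x y = 0
  · simp [hy]
  · simp [div_self hy]

theorem isCompact_maskingPairs {Y : Type*} (W : Fin 2 → X → Y → ℝ) (Q₀ : Y → ℝ) :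
    IsCompact (maskingPairs W Q₀) := by
  have hK : IsCompact (Set.univ.pi fun _ : Fin 2 => stdSimplex ℝ X) :=
    isCompact_univ_pi fun _ => isCompact_stdSimplex ℝ X
  refine hK.of_isClosed_subset ?_ fun P hP s _ => hP.1 s
  have hset : maskingPairs W Q₀ = (Set.univ.pi fun _ : Fin 2 => stdSimplex ℝ X) ∩
      ⋂ (s) (y), {P : Fin 2 → X → ℝ | outDist (P s) (W s) y = Q₀ y} := by
    ext P
    simp [maskingPairs]
  rw [hset]
  refine hK.isClosed.inter (isClosed_iInter fun s => isClosed_iInter fun y => ?_)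
  refine isClosed_eq ?_ continuous_const
  unfold outDist
  fun_prop

theorem continuousOn_mutualInfo_maskingPairs (W : Fin 2 → X → Y → ℝ) (Q₀ : Y → ℝ) (s : Fin 2) :
    ContinuousOn (fun P : Fin 2 → X → ℝ => mutualInfo (P s) (W s)) (maskingPairs W Q₀) := by
  have hcont : Continuous fun P : Fin 2 → X → ℝ =>
      (∑ x, P s x * rowDiv (W s) Q₀ x) / Real.log 2 := by fun_prop
  refine hcont.continuousOn.congr fun P hP => ?_
  beta_reduce
  rw [← mutualInfo_mul_log_two_eq_sum_rowDiv (hP.2 s),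
    mul_div_cancel_right₀ _ (Real.log_pos one_lt_two).ne']

theorem IsAchievable.mono_key {X : Type*} {W : Fin 2 → X → Y → ℝ} {Q₀ : Y → ℝ} {ζ ε : ℝ} {δ : Fin 2 → ℝ}
    {L : ℝ} {LK LK' : EReal} (h : IsAchievable W Q₀ ζ ε δ L LK) (hle : LK ≤ LK') :
    IsAchievable W Q₀ ζ ε δ L LK' := by
  obtain ⟨M, K, c, h1, h2, h3⟩ := h
  exact ⟨M, K, c, h1, h2, h3.trans hle⟩

theorem tendsto_ereal_of_le_div {f : ℝ → EReal} {c : ℝ}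
    (hlow : ∀ ε, 0 < ε → (c : EReal) ≤ f ε)
    (hup : ∀ ε, 0 < ε → ε < 1 → f ε ≤ ((c / (1 - ε) : ℝ) : EReal)) :
    Tendsto f (nhdsWithin 0 (Set.Ioi 0)) (nhds (c : EReal)) := by
  have hlim : Tendsto (fun ε : ℝ => ((c / (1 - ε) : ℝ) : EReal)) (nhdsWithin 0 (Set.Ioi 0))
      (nhds (c : EReal)) := by
    refine (continuous_coe_real_ereal.tendsto c).comp ?_
    have : ContinuousAt (fun ε : ℝ => c / (1 - ε)) 0 :=
      continuousAt_const.div (continuousAt_const.sub continuousAt_id) (by norm_num)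
    have h2 := this.tendsto.mono_left (nhdsWithin_le_nhds (s := Set.Ioi (0 : ℝ)))
    simpa using h2
  refine tendsto_of_tendsto_of_tendsto_of_le_of_le' tendsto_const_nhds hlim ?_ ?_
  · filter_upwards [self_mem_nhdsWithin] with ε hε using hlow ε hε
  · filter_upwards [self_mem_nhdsWithin, nhdsWithin_le_nhds (eventually_lt_nhds one_pos)]
      with ε hε hε1 using hup ε hε hε1

end

end CompoundCovert

/-! ### Assembly of the theorem -/

open CompoundCovert

theorem proposition1 {X Y : Type*} [Fintype X] [Fintype Y]
    (W : Fin 2 → X → Y → ℝ) (hW : ∀ s x, W s x ∈ stdSimplex ℝ Y)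
    (Q₀ : Y → ℝ) (hcase : CompoundCovert.IsCase1 W Q₀)
    (δ : Fin 2 → ℝ) (hδ : ∀ s, 0 < δ s) :
    ∃ C : Fin 2 → ℝ,
      (∀ s, IsGreatest
        ((fun P : Fin 2 → X → ℝ => CompoundCovert.mutualInfo (P s) (W s)) ''
          CompoundCovert.maskingPairs W Q₀) (C s)) ∧
      Filter.Tendsto (fun ε : ℝ => CompoundCovert.optThroughputInfKey W Q₀ 1 ε δ)
        (nhdsWithin 0 (Set.Ioi 0)) (nhds ((min (C 0) (C 1) : ℝ) : EReal)) ∧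
      Filter.Tendsto (fun ε : ℝ => CompoundCovert.optThroughput W Q₀ 1 ε δ)
        (nhdsWithin 0 (Set.Ioi 0)) (nhds ((min (C 0) (C 1) : ℝ) : EReal)) ∧
      ((∃ P ∈ CompoundCovert.maskingPairs W Q₀,
          ∀ s, ∃ x x' : X, P s x ≠ 0 ∧ P s x' ≠ 0 ∧ W s x ≠ W s x') ↔
        ∃ L : ℝ, 0 < L ∧ ∀ ε : ℝ, 0 < ε → CompoundCovert.IsAchievable W Q₀ 1 ε δ L ⊤) := by
  obtain ⟨P₀, hP₀, -⟩ := hcase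
  have hQ : Q₀ ∈ stdSimplex ℝ Y := by
    rw [← funext (hP₀.2 0)]
    exact outDist_mem_stdSimplex (hP₀.1 0) (hW 0)
  have hmax : ∀ s, ∃ P ∈ maskingPairs W Q₀, ∀ P' ∈ maskingPairs W Q₀,
      mutualInfo (P' s) (W s) ≤ mutualInfo (P s) (W s) := fun s => by
    obtain ⟨P, hP, h⟩ := (isCompact_maskingPairs W Q₀).exists_isMaxOn ⟨P₀, hP₀⟩
      (continuousOn_mutualInfo_maskingPairs W Q₀ s)
    exact ⟨P, hP, fun P' hP' => h hP'⟩
  choose Pm hPm hPmax using hmax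
  -- Combining the two maximisers is allowed by the product structure; one pair attains both maxima.
  have hPs : (fun s => Pm s s) ∈ maskingPairs W Q₀ :=
    ⟨fun s => (hPm s).1 s, fun s => (hPm s).2 s⟩
  obtain ⟨C, hC⟩ : ∃ C : Fin 2 → ℝ, ∀ s, C s = mutualInfo (Pm s s) (W s) := ⟨_, fun _ => rfl⟩
  have hmin : ∀ s, min (C 0) (C 1) ≤ C s := fun s => by fin_cases s <;> simp
  have hconv : ∀ {ε L : ℝ} {LK : EReal}, ε < 1 → IsAchievable W Q₀ 1 ε δ L LK →
      ∀ s, (1 - ε) * L ≤ C s := by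
    intro ε L LK hε h s
    obtain ⟨P, hP, hPQ, hle⟩ := h.exists_mutualInfo_ge hW hQ hε s
    rw [hC s]
    refine hle.trans ?_
    have hupd : Function.update P₀ s P ∈ maskingPairs W Q₀ := by
      constructor <;> intro s' <;> by_cases hs : s' = s
      · subst hs; simpa using hP
      · simpa [hs] using hP₀.1 s'
      · subst hs; simpa using hPQ
      · simpa [hs] using hP₀.2 s'
    simpa using hPmax s _ hupd
  have hdirect : ∀ {ε L : ℝ}, 0 < ε → 0 ≤ L → (∀ s, L = 0 ∨ L < C s) →
      ∃ LK : ℝ, 0 ≤ LK ∧ IsAchievable W Q₀ 1 ε δ L (LK : EReal) := fun hε hL h =>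
    exists_isAchievable_of_lt hW hPs hε hδ hL fun s => hC s ▸ h s
  have hup : ∀ {ε L : ℝ} {LK : EReal}, ε < 1 → IsAchievable W Q₀ 1 ε δ L LK →
      (L : EReal) ≤ ((min (C 0) (C 1) / (1 - ε) : ℝ) : EReal) := by
    intro ε L LK hε h
    rw [EReal.coe_le_coe_iff, le_div_iff₀ (by linarith), mul_comm]
    exact le_min (hconv hε h 0) (hconv hε h 1)
  have hlow : ∀ (f : EReal) {ε : ℝ}, 0 < ε → (∀ L LK : ℝ, 0 ≤ L → 0 ≤ LK →
      IsAchievable W Q₀ 1 ε δ L (LK : EReal) → (L : EReal) ≤ f) →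
      ((min (C 0) (C 1) : ℝ) : EReal) ≤ f := by
    intro f ε hε hf
    refine le_of_forall_lt fun z hz => ?_
    obtain ⟨L, hzL, hL⟩ := EReal.lt_iff_exists_real_btwn.mp hz
    rw [EReal.coe_lt_coe_iff] at hL
    -- Truncation at zero keeps the rate admissible, and covers a minimum equal to zero by the
    -- rate-zero code.
    have hL' : ∀ s, max L 0 = 0 ∨ max L 0 < C s := fun s => by
      rcases le_total L 0 with h | h
      · exact Or.inl (max_eq_right h)
      · rw [max_eq_left h]; exact Or.inr (hL.trans_le (hmin s))
    obtain ⟨LK, hLK, h⟩ := hdirect hε (le_max_right L 0) hL'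
    exact hzL.trans_le (le_trans (EReal.coe_le_coe_iff.mpr (le_max_left L 0))
      (hf _ LK (le_max_right L 0) hLK h))
  refine ⟨C, fun s => ⟨⟨Pm s, hPm s, (hC s).symm⟩, ?_⟩, ?_, ?_, ?_, ?_⟩
  · rintro _ ⟨P, hP, rfl⟩
    rw [hC s]
    exact hPmax s P hP
  · refine tendsto_ereal_of_le_div (fun ε hε => hlow _ hε fun L LK hL _ h => ?_)
      (fun ε _ hε1 => sSup_le ?_)
    · exact le_sSup ⟨L, hL, rfl, h.mono_key le_top⟩
    · rintro _ ⟨L, -, rfl, h⟩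
      exact hup hε1 h
  · refine tendsto_ereal_of_le_div (fun ε hε => hlow _ hε fun L LK hL hLK h => ?_)
      (fun ε _ hε1 => sSup_le ?_)
    · exact le_sSup ⟨L, LK, hL, hLK, rfl, h⟩
    · rintro _ ⟨L, LK, -, -, rfl, h⟩
      exact hup hε1 h
  · rintro ⟨P, hP, hne⟩
    have hpos : ∀ s, 0 < C s := fun s => by
      obtain ⟨x, x', hx, hx', hxx'⟩ := hne s
      rw [hC s]
      exact (mutualInfo_pos (hP.1 s) (hW s) hx hx' hxx').trans_le (hPmax s P hP)
    have hc : 0 < min (C 0) (C 1) := lt_min (hpos 0) (hpos 1)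
    refine ⟨min (C 0) (C 1) / 2, half_pos hc, fun ε hε => ?_⟩
    obtain ⟨LK, -, h⟩ := hdirect hε (half_pos hc).le
      fun s => Or.inr ((half_lt_self hc).trans_le (hmin s))
    exact h.mono_key le_top
  · rintro ⟨L, hL, h⟩
    refine ⟨_, hPs, fun s => exists_ne_of_mutualInfo_pos (hPs.1 s) ?_⟩
    rw [← hC s]
    -- Any fixed `ε < 1` works: at `1 / 2` the converse gives `L / 2 ≤ C s`.
    have := hconv (by norm_num) (h (1 / 2) (by norm_num)) s
    linarith
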